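/- **Setting.** Let $(a_i)_{i\ge1},(b_i)_{i\ge1}$ be real sequences with $a_i<b_i$. For each $i$ let $\varphi_i$ be a probability density on $[a_i,b_i]$ whose distribution function $\Phi_i(x)=\int_{a_i}^x\varphi_i(y)\,dy$ is a bijection $[a_i,b_i]\to[0,1]$. Let $\gamma_{\mathfrak u}\ge 0$ be weights indexed by the finite sets $\mathfrak u\subset\mathbb N=\{1,2,\dots\}$. Put $[s]=\{1,\dots,s\}$. For $F:\prod_{i=1}^s[a_i,b_i]\to\mathbb R$ whose iterated partial derivatives $\partial^{|\mathfrak u|}F/\partial x_{\mathfrak u}=\partial^kF/\partial x_{u_1}\cdots\partial x_{u_k}$ exist for all $\mathfrak u=\{u_1<\dots<u_k\}\subseteq[s]$, let $\|F\|=\max_{\mathfrak u\subseteq[s]}\gamma_{\mathfrak u}^{-1}\sup_{x}|\partial^{|\mathfrak u|}F/\partial x_{\mathfrak u}(x)|$, with $0/0=0$ and $c/0=\infty$ for $c>0$. For points $y_0,\dots,y_{N-1}\in[0,1)^s$ the worst-case error is $$\mathrm{wce}(\{y_n\})=\sup_{\|F\|\le1}\Big|\frac1N\sum_{n=0}^{N-1}F\big(\Phi_1^{-1}(y_{n,1}),\dots,\Phi_s^{-1}(y_{n,s})\big)-\int_{\prod_i[a_i,b_i]}F(x)\prod_{i=1}^s\varphi_i(x_i)\,dx\Big|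 .$$ For $f\in\mathbb F_2[x]$ of degree $m$ and $g\in\mathbb F_2[x]^s$, the polynomial lattice point set $\mathcal P(g,f)$ consists of the $2^m$ points $(\{hg_1/f\}_m,\dots,\{hg_s/f\}_m)$, $h\in G_m=\{h\in\mathbb F_2[x]:\deg h<m\}$, where $\{\sum_k a_kx^{-k}\}_m=\sum_{k=1}^m a_k2^{-k}$ for Laurent series in $\mathbb F_2((x^{-1}))$. For $x=\sum_{i\ge1}\xi_i2^{-i}\in[0,1)$ (infinitely many digits different from $1$) and $k=\sum_{i\ge0}\kappa_i2^i$, let $\mathrm{wal}_k(x)=(-1)^{\sum_i\kappa_i\xi_{i+1}}$, and let $\mu(k)$ be the number of binary digits of $k\geq 1$. Define $$B_\gamma(g,f)=\sum_{\emptyset\ne\mathfrak u\subseteq[s]}\gamma_{\mathfrak u}\prod_{i\in\mathfrak u}(b_i-a_i)\sum_{k\in\{1,\dots,2^m-1\}^{\mathfrak u}}2^{-\sum_{i\in\mathfrak u}\mu(k_i)}\Big|\frac1{2^m}\sum_{y\in\mathcal P(g,f)}\prod_{i\in\mathfrak u}\mathrm{wal}_{k_i}(y_i)\Big|.$$ A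 vector $g^*\in G_m^s$ is *CBC-constructed* if $g_1^*=1$ and, for $d=2,\dots,s$, $g_d^*$ minimizes $B_\gamma((g_1^*,\dots,g_{d-1}^*,g_d),f)$ over $g_d\in G_m$. Let $N_\gamma(\varepsilon,s)$ be the least $N\ge1$ such that some $N$-element set $\mathcal P\subseteq[0,1)^s$ has $\mathrm{wce}(\mathcal P)\le\varepsilon$. The integration problem is *strongly polynomially tractable* if there are $C,\tau>0$ with $N_\gamma(\varepsilon,s)\le C\varepsilon^{-\tau}$ for all $s\ge1$, $\varepsilon\in(0,1]$; the infimum of such $\tau$ is the exponent $\tau^*$. **Theorem.** 1. Let $\delta\in(0,1)$ satisfy $$C_{\rm Poly}(\delta,\gamma)=\sup_{s\in\mathbb N}\sum_{\emptyset\ne\mathfrak u\subseteq[s]}\gamma_{\mathfrak u}\prod_{i\in\mathfrak u}\Big[\max\Big(2,\frac{|\mathfrak u|}{e\,\delta\,2\ln2}\Big)(b_i-a_i)\Big]<\infty .$$ Then for all $m,s\ge1$, every irreducible $f\in\mathbb F_2[x]$ of degree $m$, every CBC-constructed $g^*\in G_m^s$ and every $d\in[s]$, $$\mathrm{wce}\big(\mathcal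 P((g_1^*,\dots,g_d^*),f)\big)\le\frac{2\,C_{\rm Poly}(\delta,\gamma)}{2^{m(1-\delta)}} .$$ In particular the integration problem is strongly polynomially tractable with $\tau^*\le 1/(1-\delta)$. 2. Let all weights be strictly positive and suppose $$S(\gamma)=\sum_{i=1}^\infty(b_i-a_i)\max_{\mathfrak v\subseteq[i-1]}\frac{\gamma_{\mathfrak v\cup\{i\}}}{\gamma_{\mathfrak v}}<\infty ,$$ where $\gamma_\emptyset$ is read as $1$ in this formula. Let $0<\delta<\min\{1,5S(\gamma)/\ln2\}$ and let $\beta\ge0$ be any integer with $$\sum_{i=\beta+1}^\infty(b_i-a_i)\max_{\mathfrak v\subseteq[i-1]}\frac{\gamma_{\mathfrak v\cup\{i\}}}{\gamma_{\mathfrak v}}<\frac{\delta\ln2}{5}.$$ Then for all $m,s\ge1$, every irreducible $f\in\mathbb F_2[x]$ of degree $m$, every CBC-constructed $g^*\in G_m^s$ and every $d\in[s]$, $$\mathrm{wce}\big(\mathcal P((g_1^*,\dots,g_d^*),f)\big)\le\Big(\frac{5\,S(\gamma)}{\delta\ln2}\Big)^{\beta}\frac1{2^{m(1-\delta)}} .$$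 In particular, for every such $\delta$, the integration problem is strongly polynomially tractable with $\tau^*\le1/(1-\delta)$. -/

import Mathlib

open scoped ENNReal NNReal Polynomial

noncomputable section

namespace WeightedQMC

/-! Coordinates are numbered `0, 1, 2, …`, so `[s] = {1, …, s}` becomes `{0, …, s - 1}`, represented
by `Fin s` (for points and functions of `s` variables) or `Finset.range s` (for weights). -/

/-! ### Densities -/

/-- The cumulative distribution function `Φ(x) = ∫_a^x φ(y) dy`. -/
def cdf (a : ℝ) (φ : ℝ → ℝ) (x : ℝ) : ℝ := ∫ y in a..x, φ y

/-- `φ` is a probability density on `[a, b]` whose distribution function `Φ : [a, b] → [0, 1]` is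
invertible. (The integral being `1` forces `φ` to be integrable on `[a, b]`.) -/
structure IsInvertibleDensity (a b : ℝ) (φ : ℝ → ℝ) : Prop where
  nonneg : ∀ x ∈ Set.Icc a b, 0 ≤ φ x
  integral_eq_one : ∫ y in a..b, φ y = 1
  bijOn : Set.BijOn (cdf a φ) (Set.Icc a b) (Set.Icc 0 1)

/-- The inverse `Φ⁻¹ : [0, 1] → [a, b]` of the distribution function. -/
def invCdf (a b : ℝ) (φ : ℝ → ℝ) : ℝ → ℝ := Function.invFunOn (cdf a φ) (Set.Icc a b)

/-! ### The function space -/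

/-- The box `[a₁, b₁] × ⋯ × [a_s, b_s]`. -/
def box (a b : ℕ → ℝ) (s : ℕ) : Set (Fin s → ℝ) :=
  Set.Icc (fun i => a i) (fun i => b i)

/-- The partial derivative `∂F/∂x_i` on the box (one-sided at the faces `x_i = a_i`, `x_i = b_i`). -/
def partialDeriv (a b : ℕ → ℝ) {s : ℕ} (i : Fin s) (F : (Fin s → ℝ) → ℝ) : (Fin s → ℝ) → ℝ :=
  fun x => derivWithin (fun t => F (Function.update x i t)) (Set.Icc (a i) (b i)) (x i)

/-- `∂^k F / ∂x_{u₁} ∂x_{u₂} ⋯ ∂x_{u_k}` for `u = {u₁ < u₂ < ⋯ < u_k}`. -/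
def mixedPartial (a b : ℕ → ℝ) {s : ℕ} (u : Finset (Fin s)) (F : (Fin s → ℝ) → ℝ) :
    (Fin s → ℝ) → ℝ :=
  (u.sort (· ≤ ·)).foldr (partialDeriv a b) F

/-- All the mixed partial derivatives of order at most one in each variable exist on the box: each
step of the iterated differentiation defining `mixedPartial` is the derivative of a function that
is differentiable in the respective variable. -/
def HasMixedPartials (a b : ℕ → ℝ) {s : ℕ} (F : (Fin s → ℝ) → ℝ) : Prop :=
  ∀ (u : Finset (Fin s)) (i : Fin s), (∀ j ∈ u, i < j) → ∀ x ∈ box a b s,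
    DifferentiableWithinAt ℝ (fun t => mixedPartial a b u F (Function.update x i t))
      (Set.Icc (a i) (b i)) (x i)

/-- The weight `γ_u` of a set `u` of coordinates in dimension `s`. -/
def weight (γ : Finset ℕ → ℝ≥0) {s : ℕ} (u : Finset (Fin s)) : ℝ≥0 :=
  γ (u.map Fin.valEmbedding)

/-- The norm `max_u γ_u⁻¹ sup_{x ∈ [a, b]} |∂^{|u|} F / ∂x_u (x)|`, with values in `[0, ∞]`.
A zero weight forces the corresponding derivative of a function of finite norm to vanish
(`0 / 0 = 0` and `c / 0 = ∞` for `c > 0`). -/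
def supNorm (a b : ℕ → ℝ) (γ : Finset ℕ → ℝ≥0) {s : ℕ} (F : (Fin s → ℝ) → ℝ) : ℝ≥0∞ :=
  ⨆ u : Finset (Fin s), (⨆ x ∈ box a b s, ‖mixedPartial a b u F x‖ₑ) / (weight γ u : ℝ≥0∞)

/-! ### Integration errors -/

/-- The error `N⁻¹ ∑_n F(Φ⁻¹(y_n)) - ∫_{[a, b]} F(x) φ(x) dx` of the rule with nodes
`y_0, …, y_{N-1}`, where `φ(x) = ∏_i φ_i(x_i)`. -/
def err (a b : ℕ → ℝ) (φ : ℕ → ℝ → ℝ) {s N : ℕ} (y : Fin N → Fin s → ℝ)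
    (F : (Fin s → ℝ) → ℝ) : ℝ :=
  (1 / (N : ℝ)) * ∑ n, F (fun i => invCdf (a i) (b i) (φ i) (y n i))
    - ∫ x in box a b s, F x * ∏ i : Fin s, φ i (x i)

/-- The worst-case error over the unit ball of the space of functions with finite `supNorm`. -/
def wce (a b : ℕ → ℝ) (φ : ℕ → ℝ → ℝ) (γ : Finset ℕ → ℝ≥0) {s N : ℕ}
    (y : Fin N → Fin s → ℝ) : ℝ≥0∞ :=
  ⨆ (F : (Fin s → ℝ) → ℝ) (_ : HasMixedPartials a b F) (_ : supNorm a b γ F ≤ 1),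
    ENNReal.ofReal |err a b φ y F|

/-! ### Walsh functions -/

/-- The `i`-th binary digit `ξ_i` (`i ≥ 1`) of `x = ξ₁/2 + ξ₂/2² + ⋯ ∈ [0, 1)`, where infinitely
many digits differ from `1`. -/
def binDigit (x : ℝ) (i : ℕ) : ℕ := ⌊2 ^ i * x⌋₊ % 2

/-- The dyadic Walsh function `wal_k(x) = (-1)^(κ₀ξ₁ + κ₁ξ₂ + ⋯)`, with `κ_i` the binary digits
of `k`. -/
def wal (k : ℕ) (x : ℝ) : ℝ :=
  (-1) ^ ∑ i ∈ Finset.range k.size, (k.testBit i).toNat * binDigit x (i + 1)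

/-- `E(P, u) = ∑_{k ∈ {1, …, 2^m - 1}^u} 2^{-μ(k)} |2^{-m} ∑_n wal_k(y_{n,u})|` with
`μ(k) = ∑_{i ∈ u} μ(k_i)`, where `μ(k_i)` is the number of binary digits of `k_i`. -/
def walshSum (m : ℕ) {s : ℕ} (y : Fin (2 ^ m) → Fin s → ℝ) (u : Finset (Fin s)) : ℝ :=
  ∑ k ∈ Fintype.piFinset (fun _ : u => Finset.Ico 1 (2 ^ m)),
    (1 / 2 ^ (∑ i, (k i).size)) * |(1 / 2 ^ m) * ∑ n, ∏ i : u, wal (k i) (y n i)|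

/-! ### Polynomial lattice point sets -/

/-- The polynomial `κ₀ + κ₁ x + κ₂ x² + ⋯` over `𝔽₂` that is identified with the integer
`n = κ₀ + κ₁ 2 + κ₂ 2² + ⋯`. The integers `n < 2^m` correspond to the polynomials of degree less
than `m`. -/
def natToPoly (n : ℕ) : (ZMod 2)[X] :=
  ∑ i ∈ Finset.range n.size, if n.testBit i then Polynomial.X ^ i else 0

/-- The embedding `𝔽₂[x] → 𝔽₂((x⁻¹))`. The variable of the Laurent series is `x⁻¹`, so that the
coefficient with index `k` is the one of `x^{-k}`. -/
def toLaurent : (ZMod 2)[X] →+* LaurentSeries (ZMod 2) :=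
  Polynomial.eval₂RingHom HahnSeries.C (HahnSeries.single (-1 : ℤ) (1 : ZMod 2))

/-- `{∑_k a_k x^{-k}}_m = ∑_{k=1}^m a_k 2^{-k}`. -/
def fracPart (m : ℕ) (L : LaurentSeries (ZMod 2)) : ℝ :=
  ∑ k ∈ Finset.Icc 1 m, ((L.coeff (k : ℤ)).val : ℝ) / 2 ^ k

/-- The `s`-dimensional polynomial lattice point set with modulus `f` of degree `m` and generating
vector `(g 0, …, g (s - 1))`: the points `({h g_i / f}_m)_i` for `h` of degree less than `m`. -/
def polyLattice (m s : ℕ) (f : (ZMod 2)[X]) (g : ℕ → (ZMod 2)[X]) :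
    Fin (2 ^ m) → Fin s → ℝ :=
  fun n i => fracPart m (toLaurent (natToPoly n * g i) / toLaurent f)

/-- The figure of merit `B_γ((g 0, …, g (s - 1)), f)`. -/
def figureOfMerit (a b : ℕ → ℝ) (γ : Finset ℕ → ℝ≥0) (m s : ℕ) (f : (ZMod 2)[X])
    (g : ℕ → (ZMod 2)[X]) : ℝ :=
  ∑ u : Finset (Fin s) with u.Nonempty,
    (weight γ u : ℝ) * (∏ i ∈ u, (b i - a i)) * walshSum m (polyLattice m s f g) u

/-- `(g 0, …, g (s - 1))` is a possible output of the component-by-component algorithm: the first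
component is `1`, and each further component `g d` has degree less than `m` and minimizes
the figure of merit of `(g 0, …, g (d - 1), h)` over all `h` of degree less than `m`. -/
def IsCBC (a b : ℕ → ℝ) (γ : Finset ℕ → ℝ≥0) (m s : ℕ) (f : (ZMod 2)[X])
    (g : ℕ → (ZMod 2)[X]) : Prop :=
  g 0 = 1 ∧ ∀ d, 1 ≤ d → d < s → (g d).degree < m ∧
    ∀ h : (ZMod 2)[X], h.degree < m →
      figureOfMerit a b γ m (d + 1) f g ≤
        figureOfMerit a b γ m (d + 1) f (Function.update g d h)

/-! ### Constants depending on the weights -/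

/-- `C_Poly(δ, γ) = sup_s ∑_{∅ ≠ u ⊆ [s]} γ_u ∏_{i ∈ u} [max(2, |u| / (e δ 2 ln 2)) (b_i - a_i)]`. -/
def CPoly (a b : ℕ → ℝ) (γ : Finset ℕ → ℝ≥0) (δ : ℝ) : ℝ≥0∞ :=
  ⨆ s : ℕ, ENNReal.ofReal (∑ u ∈ (Finset.range s).powerset with u.Nonempty,
    (γ u : ℝ) * ∏ i ∈ u,
      (max 2 ((u.card : ℝ) / (Real.exp 1 * δ * 2 * Real.log 2)) * (b i - a i)))

/-- The ratio `γ_{v ∪ {i}} / γ_v`, where `γ_∅` is read as `1`. -/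
def weightRatio (γ : Finset ℕ → ℝ≥0) (i : ℕ) (v : Finset ℕ) : ℝ≥0 :=
  γ (insert i v) / (if v = ∅ then 1 else γ v)

/-- The summand `(b_i - a_i) max_{v ⊆ {0, …, i - 1}} γ_{v ∪ {i}} / γ_v` of `S(γ)`. -/
def STerm (a b : ℕ → ℝ) (γ : Finset ℕ → ℝ≥0) (i : ℕ) : ℝ :=
  (b i - a i) * ((Finset.range i).powerset.sup (weightRatio γ i) : ℝ≥0)

/-! ### Tractability -/

/-- The information complexity: the least number `N ≥ 1` of points of a set `P ⊆ [0, 1)^s`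
with worst-case error at most `ε` (and `∞` if there is none). -/
def infoComplexity (a b : ℕ → ℝ) (φ : ℕ → ℝ → ℝ) (γ : Finset ℕ → ℝ≥0) (ε : ℝ) (s : ℕ) : ℝ≥0∞ :=
  ⨅ (N : ℕ) (_ : 1 ≤ N ∧ ∃ y : Fin N → Fin s → ℝ, Function.Injective y ∧
    (∀ n i, y n i ∈ Set.Ico (0 : ℝ) 1) ∧ wce a b φ γ y ≤ ENNReal.ofReal ε), (N : ℝ≥0∞)

/-- `N(ε, s) ≤ C ε^{-τ}` for all `s ≥ 1` and `ε ∈ (0, 1]`, with some `C > 0`. -/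
def SPTBound (a b : ℕ → ℝ) (φ : ℕ → ℝ → ℝ) (γ : Finset ℕ → ℝ≥0) (τ : ℝ) : Prop :=
  ∃ C : ℝ, 0 < C ∧ ∀ s : ℕ, 1 ≤ s → ∀ ε : ℝ, 0 < ε → ε ≤ 1 →
    infoComplexity a b φ γ ε s ≤ ENNReal.ofReal (C * ε ^ (-τ))

/-- Strong polynomial tractability of the integration problem. -/
def StronglyPolynomiallyTractable (a b : ℕ → ℝ) (φ : ℕ → ℝ → ℝ) (γ : Finset ℕ → ℝ≥0) : Prop :=
  ∃ τ : ℝ, 0 < τ ∧ SPTBound a b φ γ τ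

/-- The exponent `τ*` of strong polynomial tractability. -/
def sptExponent (a b : ℕ → ℝ) (φ : ℕ → ℝ → ℝ) (γ : Finset ℕ → ℝ≥0) : ℝ :=
  sInf {τ : ℝ | 0 < τ ∧ SPTBound a b φ γ τ}

end WeightedQMC

end

noncomputable section

namespace WeightedQMC

/-! ### Walsh functions on the dyadic grid -/

/-- The value `wal_k(a / 2^m)` of the Walsh function at a grid point. -/
def gridWal (m k a : ℕ) : ℝ :=
  ∏ i ∈ Finset.range m, if k.testBit i && a.testBit (m - 1 - i) then -1 else 1

theorem binDigit_grid {m i : ℕ} (hi : i < m) (a : ℕ) :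
    binDigit ((a : ℝ) / 2 ^ m) (i + 1) = (a.testBit (m - 1 - i)).toNat := by
  obtain ⟨j, rfl⟩ : ∃ j, m = (i + 1) + j := ⟨m - (i + 1), by omega⟩
  have e : i + 1 + j - 1 - i = j := by omega
  have h : (2 : ℝ) ^ (i + 1) * ((a : ℝ) / 2 ^ (i + 1 + j)) = (a : ℝ) / ((2 ^ j : ℕ) : ℝ) := by
    rw [Nat.cast_pow, Nat.cast_ofNat, pow_add 2 (i + 1) j]
    field_simp
  rw [e]
  rw [binDigit, h, Nat.floor_div_natCast, Nat.floor_natCast, Nat.toNat_testBit]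

theorem wal_grid {m k : ℕ} (hk : k < 2 ^ m) (a : ℕ) :
    wal k ((a : ℝ) / 2 ^ m) = gridWal m k a := by
  have hs : k.size ≤ m := Nat.size_le.2 hk
  rw [wal, gridWal, ← Finset.prod_pow_eq_pow_sum,
    ← Finset.prod_subset (Finset.range_mono hs)]
  · refine Finset.prod_congr rfl fun i hi => ?_
    rw [binDigit_grid (lt_of_lt_of_le (Finset.mem_range.1 hi) hs)]
    cases k.testBit i <;> cases a.testBit (m - 1 - i) <;> simp
  · intro i _ hi
    have : k.testBit i = false := Nat.testBit_eq_false_of_lt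
      (Nat.size_le.1 (by simpa using hi))
    simp [this]

theorem gridWal_comm (m k a : ℕ) : gridWal m k a = gridWal m a k := by
  rw [gridWal, gridWal, ← Finset.prod_range_reflect]
  refine Finset.prod_congr rfl fun i hi => ?_
  have : m - 1 - (m - 1 - i) = i := by have := Finset.mem_range.1 hi; omega
  rw [this, Bool.and_comm]

theorem gridWal_xor_left (m k l a : ℕ) :
    gridWal m (k ^^^ l) a = gridWal m k a * gridWal m l a := by
  simp only [gridWal, ← Finset.prod_mul_distrib]
  refine Finset.prod_congr rfl fun i _ => ?_
  rw [Nat.testBit_xor]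
  cases k.testBit i <;> cases l.testBit i <;> cases a.testBit (m - 1 - i) <;> simp

theorem gridWal_xor_right (m k a c : ℕ) :
    gridWal m k (a ^^^ c) = gridWal m k a * gridWal m k c := by
  simp only [gridWal_comm m k, gridWal_xor_left]

theorem gridWal_zero_left (m a : ℕ) : gridWal m 0 a = 1 := by simp [gridWal]

theorem abs_gridWal (m k a : ℕ) : |gridWal m k a| = 1 := by
  rw [gridWal, Finset.abs_prod]
  refine Finset.prod_eq_one fun i _ => ?_
  split_ifs <;> simp

theorem gridWal_mul_self (m k a : ℕ) : gridWal m k a * gridWal m k a = 1 := by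
  rw [← abs_mul_abs_self, abs_gridWal, one_mul]

theorem gridWal_two_pow_right {m k p : ℕ} (hp : p < m) (h : k.testBit (m - 1 - p) = true) :
    gridWal m k (2 ^ p) = -1 := by
  rw [gridWal, Finset.prod_eq_single (m - 1 - p)]
  · have : m - 1 - (m - 1 - p) = p := by omega
    simp [h, this]
  · intro i hi hne
    have : p ≠ m - 1 - i := by have := Finset.mem_range.1 hi; omega
    simp [Nat.testBit_two_pow_of_ne this]
  · intro h; exact absurd (Finset.mem_range.2 (by omega)) h

/-- A sum over `{0, …, 2^m - 1}` vanishes if shifting by some `c` changes the signs of its terms. -/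
theorem sum_eq_zero_of_xor_neg {m c : ℕ} (hc : c < 2 ^ m) (χ : ℕ → ℝ)
    (h : ∀ n < 2 ^ m, χ (n ^^^ c) = -χ n) : ∑ n ∈ Finset.range (2 ^ m), χ n = 0 := by
  have : ∑ n ∈ Finset.range (2 ^ m), χ n = ∑ n ∈ Finset.range (2 ^ m), χ (n ^^^ c) := by
    refine Finset.sum_nbij' (· ^^^ c) (· ^^^ c) ?_ ?_ ?_ ?_ ?_
    · intro n hn
      exact Finset.mem_range.2 (Nat.xor_lt_two_pow (Finset.mem_range.1 hn) hc)
    · intro n hn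
      exact Finset.mem_range.2 (Nat.xor_lt_two_pow (Finset.mem_range.1 hn) hc)
    · intro n _; simp
    · intro n _; simp
    · intro n _; simp
  rw [Finset.sum_congr rfl fun n hn => h n (Finset.mem_range.1 hn),
    Finset.sum_neg_distrib] at this
  linarith

theorem sum_gridWal_left {m a : ℕ} (ha : a < 2 ^ m) (h0 : a ≠ 0) :
    ∑ k ∈ Finset.range (2 ^ m), gridWal m k a = 0 := by
  obtain ⟨p, hp⟩ := Nat.exists_testBit_of_ne_zero h0
  have hpm : p < m := by
    by_contra hle
    have := Nat.ge_two_pow_of_testBit hp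
    have := Nat.pow_le_pow_right (n := 2) (by norm_num) (not_lt.1 hle)
    omega
  refine sum_eq_zero_of_xor_neg (c := 2 ^ (m - 1 - p)) (Nat.pow_lt_pow_right (by norm_num)
    (by omega)) _ fun n _ => ?_
  rw [gridWal_xor_left, gridWal_comm m (2 ^ _), gridWal_two_pow_right (by omega), mul_neg_one]
  rwa [show m - 1 - (m - 1 - p) = p by omega]

/-- Orthogonality of the columns of the Walsh matrix. -/
theorem sum_gridWal_mul {m a c : ℕ} (ha : a < 2 ^ m) (hc : c < 2 ^ m) :
    ∑ k ∈ Finset.range (2 ^ m), gridWal m k a * gridWal m k c = if a = c then 2 ^ m else 0 := by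
  split_ifs with h
  · simp [h, gridWal_mul_self]
  · simp only [← gridWal_xor_right]
    exact sum_gridWal_left (Nat.xor_lt_two_pow ha hc) (by simpa [Nat.xor_eq_zero_iff] using h)

theorem sum_range_mul_eq {M : Type*} [AddCommMonoid M] (n D : ℕ) (h : ℕ → M) :
    ∑ a ∈ Finset.range (n * D), h a
      = ∑ q ∈ Finset.range n, ∑ o ∈ Finset.range D, h (q * D + o) := by
  induction n with
  | zero => simp
  | succ n ih => rw [Nat.succ_mul, Finset.sum_range_add, ih, Finset.sum_range_succ]

theorem mul_two_pow_add_xor (q : ℕ) {p o : ℕ} (ho : o < 2 ^ p) :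
    (q * (2 ^ p + 2 ^ p) + o) ^^^ 2 ^ p = q * (2 ^ p + 2 ^ p) + (2 ^ p + o) := by
  have e : q * (2 ^ p + 2 ^ p) = 2 ^ (p + 1) * q := by ring
  have h1 : o < 2 ^ (p + 1) := by rw [pow_succ]; omega
  have h2 : 2 ^ p + o < 2 ^ (p + 1) := by rw [pow_succ]; omega
  refine Nat.eq_of_testBit_eq fun j => ?_
  rw [e, Nat.testBit_xor, Nat.testBit_two_pow_mul_add _ h1, Nat.testBit_two_pow_mul_add _ h2]
  rcases lt_trichotomy j p with hj | rfl | hj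
  · rw [if_pos (by omega), if_pos (by omega), Nat.testBit_two_pow_add_gt hj,
      Nat.testBit_two_pow_of_ne (by omega), Bool.xor_false]
  · rw [if_pos (by omega), if_pos (by omega), Nat.testBit_two_pow_add_eq, Nat.testBit_two_pow_self,
      Bool.xor_true]
  · rw [if_neg (by omega), if_neg (by omega), Nat.testBit_two_pow_of_ne (by omega), Bool.xor_false]

theorem testBit_size_sub_one {k : ℕ} (hk : k ≠ 0) : k.testBit (k.size - 1) = true := by
  have h1 : 0 < k.size := Nat.size_pos.2 (Nat.pos_of_ne_zero hk)
  refine Nat.testBit_of_two_pow_le_and_two_pow_add_one_gt (Nat.lt_size.1 (by omega)) ?_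
  rw [Nat.sub_add_cancel h1]
  exact Nat.lt_size_self k

/-- The `k`-th Walsh coefficient of a function on the grid with Lipschitz constant `M` with respect
to a nondecreasing sequence of nodes. -/
theorem abs_sum_gridWal_le {m k : ℕ} (hk0 : k ≠ 0) (hk : k < 2 ^ m) {A B M : ℝ} (hM : 0 ≤ M)
    (t : ℕ → ℝ) (ht : Monotone t) (htA : ∀ n, A ≤ t n) (htB : ∀ n, t n ≤ B) (h : ℕ → ℝ)
    (hh : ∀ x < 2 ^ m, ∀ y < 2 ^ m, x ≤ y → |h x - h y| ≤ M * (t y - t x)) :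
    |1 / 2 ^ m * ∑ a ∈ Finset.range (2 ^ m), gridWal m k a * h a|
      ≤ M * ((B - A) * (1 / 2 ^ k.size)) := by
  have hr1 : 0 < k.size := Nat.size_pos.2 (Nat.pos_of_ne_zero hk0)
  have hrm : k.size ≤ m := Nat.size_le.2 hk
  obtain ⟨p, hp⟩ : ∃ p, m = p + k.size := ⟨m - k.size, by omega⟩
  obtain ⟨D, hD⟩ : ∃ D, D = 2 ^ p := ⟨_, rfl⟩
  have hN : 2 ^ m = 2 ^ (k.size - 1) * (D + D) := by
    rw [hD, ← two_mul, ← pow_succ', ← pow_add]; congr 1; omega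
  have hlt : ∀ q < 2 ^ (k.size - 1), ∀ o < D, q * (D + D) + (D + o) < 2 ^ m := by
    intro q hq o ho
    rw [hN]
    calc q * (D + D) + (D + o) < q * (D + D) + (D + D) := by omega
      _ = (q + 1) * (D + D) := by ring
      _ ≤ _ := Nat.mul_le_mul_right _ hq
  have hsum : ∑ a ∈ Finset.range (2 ^ m), gridWal m k a * h a
      = ∑ q ∈ Finset.range (2 ^ (k.size - 1)), ∑ o ∈ Finset.range D,
          gridWal m k (q * (D + D) + o) * (h (q * (D + D) + o) - h (q * (D + D) + (D + o))) := by
    rw [hN, sum_range_mul_eq]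
    refine Finset.sum_congr rfl fun q _ => ?_
    rw [Finset.sum_range_add, ← Finset.sum_add_distrib]
    refine Finset.sum_congr rfl fun o ho => ?_
    have ex : q * (D + D) + (D + o) = (q * (D + D) + o) ^^^ 2 ^ p := by
      rw [hD, mul_two_pow_add_xor q (hD ▸ Finset.mem_range.1 ho)]
    have ew : gridWal m k (q * (D + D) + (D + o)) = -gridWal m k (q * (D + D) + o) := by
      rw [ex, gridWal_xor_right, gridWal_two_pow_right (p := p) (by omega), mul_neg_one]
      rw [show m - 1 - p = k.size - 1 by omega]; exact testBit_size_sub_one hk0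
    rw [ew]; ring
  have hbound : |∑ a ∈ Finset.range (2 ^ m), gridWal m k a * h a| ≤ D * (M * (B - A)) := by
    rw [hsum]
    calc _ ≤ ∑ q ∈ Finset.range (2 ^ (k.size - 1)), ∑ o ∈ Finset.range D,
          M * (t ((q + 1) * (D + D) + o) - t (q * (D + D) + o)) := by
          refine (Finset.abs_sum_le_sum_abs _ _).trans (Finset.sum_le_sum fun q hq => ?_)
          refine (Finset.abs_sum_le_sum_abs _ _).trans (Finset.sum_le_sum fun o ho => ?_)
          have h2 := hlt q (Finset.mem_range.1 hq) o (Finset.mem_range.1 ho)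
          rw [abs_mul, abs_gridWal, one_mul]
          refine (hh _ (by omega) _ h2 (by omega)).trans (mul_le_mul_of_nonneg_left ?_ hM)
          refine sub_le_sub_right (ht ?_) _
          rw [add_mul]; omega
      _ = ∑ o ∈ Finset.range D, M * (t (2 ^ (k.size - 1) * (D + D) + o) - t o) := by
          rw [Finset.sum_comm]
          refine Finset.sum_congr rfl fun o _ => ?_
          rw [← Finset.mul_sum, Finset.sum_range_sub (fun q => t (q * (D + D) + o))]
          simp
      _ ≤ ∑ o ∈ Finset.range D, M * (B - A) :=
          Finset.sum_le_sum fun o _ => mul_le_mul_of_nonneg_left (sub_le_sub (htB _) (htA _)) hM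
      _ = _ := by simp
  have hcast : (2 : ℝ) ^ m = D * 2 ^ k.size := by
    conv_lhs => rw [hp, pow_add]
    rw [hD]; push_cast; rfl
  rw [abs_mul, abs_of_pos (by positivity : (0 : ℝ) < 1 / 2 ^ m)]
  calc _ ≤ 1 / 2 ^ m * (D * (M * (B - A))) := mul_le_mul_of_nonneg_left hbound (by positivity)
    _ = _ := by rw [hcast]; have : (0 : ℝ) < D := by rw [hD]; positivity
                field_simp

/-! ### Iterated partial derivatives -/

theorem update_mem_box {a b : ℕ → ℝ} {s : ℕ} {x : Fin s → ℝ} (hx : x ∈ box a b s) (i : Fin s)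
    {t : ℝ} (ht : t ∈ Set.Icc (a i) (b i)) : Function.update x i t ∈ box a b s := by
  constructor <;> intro j <;> by_cases hj : j = i
  · subst hj; simpa using ht.1
  · simpa [hj] using hx.1 j
  · subst hj; simpa using ht.2
  · simpa [hj] using hx.2 j

/-- `G` is differentiable in the variable `i` on the box. -/
def PartialDiff (a b : ℕ → ℝ) {s : ℕ} (i : Fin s) (G : (Fin s → ℝ) → ℝ) : Prop :=
  ∀ x ∈ box a b s,
    DifferentiableWithinAt ℝ (fun t => G (Function.update x i t)) (Set.Icc (a i) (b i)) (x i)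

theorem PartialDiff.hasDerivWithinAt {a b : ℕ → ℝ} {s : ℕ} {i : Fin s} {G : (Fin s → ℝ) → ℝ}
    (hG : PartialDiff a b i G) {x : Fin s → ℝ} (hx : x ∈ box a b s) {t : ℝ}
    (ht : t ∈ Set.Icc (a i) (b i)) :
    HasDerivWithinAt (fun τ => G (Function.update x i τ))
      (partialDeriv a b i G (Function.update x i t)) (Set.Icc (a i) (b i)) t := by
  have h := (hG _ (update_mem_box hx i ht)).hasDerivWithinAt
  simpa [partialDeriv] using h

/-- All derivatives in the successive application of `partialDeriv` along a list exist. -/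
def PartialDiffList (a b : ℕ → ℝ) {s : ℕ} : List (Fin s) → ((Fin s → ℝ) → ℝ) → Prop
  | [], _ => True
  | i :: l, G => PartialDiff a b i G ∧ PartialDiffList a b l (partialDeriv a b i G)

/-- Successive application of `partialDeriv` along a list, the head being applied first. -/
def partialDerivs (a b : ℕ → ℝ) {s : ℕ} (l : List (Fin s)) (G : (Fin s → ℝ) → ℝ) :
    (Fin s → ℝ) → ℝ :=
  l.foldl (fun H i => partialDeriv a b i H) G

theorem partialDerivs_eq_mixedPartial (a b : ℕ → ℝ) {s : ℕ} {l : List (Fin s)}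
    (hl : l.Pairwise (· > ·)) (G : (Fin s → ℝ) → ℝ) :
    partialDerivs a b l G = mixedPartial a b l.toFinset G := by
  have h : l.toFinset.sort (· ≤ ·) = l.reverse := by
    rw [← List.toFinset_reverse, List.toFinset_sort (· ≤ ·)]
    · exact List.pairwise_reverse.2 (hl.imp fun h => h.le)
    · exact (List.pairwise_reverse.2 (hl.imp fun h => h.ne))
  rw [mixedPartial, h, List.foldr_reverse, partialDerivs]

theorem HasMixedPartials.partialDiffList {a b : ℕ → ℝ} {s : ℕ} {F : (Fin s → ℝ) → ℝ}
    (hF : HasMixedPartials a b F) (q : List (Fin s)) :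
    ∀ p : List (Fin s), (p ++ q).Pairwise (· > ·) →
      PartialDiffList a b q (partialDerivs a b p F) := by
  induction q with
  | nil => intro _ _; trivial
  | cons i q ih =>
    intro p hp
    have hp' := List.pairwise_append.1 hp
    constructor
    · intro x hx
      rw [partialDerivs_eq_mixedPartial a b hp'.1]
      refine hF _ i (fun j hj => ?_) x hx
      exact hp'.2.2 j (List.mem_toFinset.1 hj) i (List.mem_cons_self)
    · have := ih (p ++ [i]) (by simpa using hp)
      simpa [partialDerivs] using this

/-- The decreasing enumeration of a set of coordinates. -/
def descList {s : ℕ} (u : Finset (Fin s)) : List (Fin s) := (u.sort (· ≤ ·)).reverse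

theorem descList_pairwise {s : ℕ} (u : Finset (Fin s)) : (descList u).Pairwise (· > ·) := by
  have := Finset.sortedLT_sort u
  exact List.pairwise_reverse.2 this.pairwise

theorem descList_toFinset {s : ℕ} (u : Finset (Fin s)) : (descList u).toFinset = u := by
  simp [descList]

theorem mem_descList {s : ℕ} {u : Finset (Fin s)} {i : Fin s} : i ∈ descList u ↔ i ∈ u := by
  simp [descList]

theorem descList_nodup {s : ℕ} (u : Finset (Fin s)) : (descList u).Nodup :=
  (descList_pairwise u).imp fun h => h.ne'

theorem partialDerivs_descList (a b : ℕ → ℝ) {s : ℕ} (u : Finset (Fin s))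
    (G : (Fin s → ℝ) → ℝ) : partialDerivs a b (descList u) G = mixedPartial a b u G := by
  rw [partialDerivs_eq_mixedPartial a b (descList_pairwise u), descList_toFinset]

/-! ### Partial Walsh transforms -/

/-- The Walsh coefficients with indices `k i` in the variables `i` of a list, with respect to the
nodes `t i 0, t i 1, …`. -/
def walshOp (m : ℕ) {s : ℕ} (t : Fin s → ℕ → ℝ) (k : Fin s → ℕ) :
    List (Fin s) → ((Fin s → ℝ) → ℝ) → (Fin s → ℝ) → ℝ
  | [], G => G
  | i :: l, G => fun x => 1 / 2 ^ m * ∑ c ∈ Finset.range (2 ^ m),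
      gridWal m (k i) c * walshOp m t k l G (Function.update x i (t i c))

theorem walshOp_hasDerivWithinAt {a b : ℕ → ℝ} {m s : ℕ} {t : Fin s → ℕ → ℝ} (k : Fin s → ℕ)
    (ht : ∀ (i : Fin s) c, t i c ∈ Set.Icc (a i) (b i)) {i : Fin s} {G : (Fin s → ℝ) → ℝ}
    (hG : PartialDiff a b i G) {l : List (Fin s)} (hi : i ∉ l) :
    ∀ {x : Fin s → ℝ}, x ∈ box a b s → ∀ {τ : ℝ}, τ ∈ Set.Icc (a i) (b i) →
    HasDerivWithinAt (fun τ => walshOp m t k l G (Function.update x i τ))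
      (walshOp m t k l (partialDeriv a b i G) (Function.update x i τ))
      (Set.Icc (a i) (b i)) τ := by
  induction l with
  | nil => intro x hx τ hτ; exact hG.hasDerivWithinAt hx hτ
  | cons j l ih =>
    intro x hx τ hτ
    have hij : i ≠ j := fun h => hi (h ▸ List.mem_cons_self)
    simp only [walshOp, Function.update_comm hij]
    refine HasDerivWithinAt.const_mul _ (HasDerivWithinAt.fun_sum fun c _ => ?_)
    exact (ih (fun h => hi (List.mem_cons_of_mem _ h))
      (update_mem_box hx j (ht j c)) hτ).const_mul _

theorem abs_walshOp_le {a b : ℕ → ℝ} {m s : ℕ} {t : Fin s → ℕ → ℝ} {k : Fin s → ℕ}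
    (ht : ∀ (i : Fin s) c, t i c ∈ Set.Icc (a i) (b i)) (htm : ∀ i, Monotone (t i))
    (hk : ∀ i, k i < 2 ^ m) {M : ℝ} (hM : 0 ≤ M) :
    ∀ {l : List (Fin s)}, l.Nodup → (∀ i ∈ l, k i ≠ 0) → ∀ {G : (Fin s → ℝ) → ℝ},
    PartialDiffList a b l G → (∀ x ∈ box a b s, |partialDerivs a b l G x| ≤ M) →
    ∀ x ∈ box a b s, |walshOp m t k l G x|
      ≤ M * (l.map fun i : Fin s => (b i - a i) * (1 / 2 ^ (k i).size)).prod
  | [], _, _, G, _, hb, x, hx => by simpa [walshOp, partialDerivs] using hb x hx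
  | i :: l, hl, hk0, G, hG, hb, x, hx => by
    have hl' := List.nodup_cons.1 hl
    have hab : ∀ j : Fin s, a j ≤ b j := fun j => (ht j 0).1.trans (ht j 0).2
    have ih : ∀ x ∈ box a b s, |walshOp m t k l (partialDeriv a b i G) x|
        ≤ M * (l.map fun i : Fin s => (b i - a i) * (1 / 2 ^ (k i).size)).prod :=
      abs_walshOp_le ht htm hk hM hl'.2 (fun j hj => hk0 j (List.mem_cons_of_mem _ hj)) hG.2
        (by simpa [partialDerivs] using hb)
    have hP : 0 ≤ M * (l.map fun i : Fin s => (b i - a i) * (1 / 2 ^ (k i).size)).prod := by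
      refine mul_nonneg hM (List.prod_nonneg fun y hy => ?_)
      obtain ⟨j, _, rfl⟩ := List.mem_map.1 hy
      exact mul_nonneg (sub_nonneg.2 (hab j)) (by positivity)
    have h := abs_sum_gridWal_le (hk0 i List.mem_cons_self) (hk i) hP (t i) (htm i)
      (fun n => (ht i n).1) (fun n => (ht i n).2)
      (fun c => walshOp m t k l G (Function.update x i (t i c))) (fun y _ z _ hyz => by
        have := (convex_Icc (a i) (b i)).norm_image_sub_le_of_norm_hasDerivWithin_le
          (fun τ hτ => walshOp_hasDerivWithinAt k ht hG.1 hl'.1 hx hτ)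
          (fun τ hτ => ih _ (update_mem_box hx i hτ)) (ht i z) (ht i y)
        rwa [Real.norm_eq_abs, Real.norm_eq_abs, abs_sub_comm (t i y),
          abs_of_nonneg (sub_nonneg.2 (htm i hyz))] at this)
    rw [List.map_cons, List.prod_cons, mul_left_comm]
    simpa [walshOp, mul_comm, mul_left_comm, mul_assoc] using h

/-! ### Discrete Walsh expansion in several variables -/

theorem sum_eq_sum_average_update {s N : ℕ} (hN : N ≠ 0) (i : Fin s)
    (K : (Fin s → Fin N) → ℝ) :
    ∑ j, K j = ∑ j, 1 / (N : ℝ) * ∑ c, K (Function.update j i c) := by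
  have h : ∑ p : (Fin s → Fin N) × Fin N, K (Function.update p.1 i p.2)
      = ∑ p : (Fin s → Fin N) × Fin N, K p.1 := by
    refine Finset.sum_nbij' (fun p => (Function.update p.1 i p.2, p.1 i))
      (fun p => (Function.update p.1 i p.2, p.1 i)) ?_ ?_ ?_ ?_ ?_ <;> simp
  rw [Fintype.sum_prod_type, Fintype.sum_prod_type] at h
  rw [← Finset.mul_sum, h]
  simp only [Finset.sum_const, Finset.card_univ, Fintype.card_fin, nsmul_eq_mul]
  rw [← Finset.mul_sum, ← mul_assoc, one_div_mul_cancel (by exact_mod_cast hN), one_mul]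

/-- The grid point with multi-index `j`. -/
def gridPoint {s N : ℕ} (t : Fin s → ℕ → ℝ) (j : Fin s → Fin N) : Fin s → ℝ :=
  fun i => t i (j i)

theorem gridPoint_update {s N : ℕ} (t : Fin s → ℕ → ℝ) (j : Fin s → Fin N) (i : Fin s)
    (c : Fin N) :
    gridPoint t (Function.update j i c) = Function.update (gridPoint t j) i (t i c) := by
  ext i'
  by_cases h : i' = i
  · subst h; simp [gridPoint]
  · simp [gridPoint, h]

theorem sum_walshOp {m s : ℕ} (t : Fin s → ℕ → ℝ) (k : Fin s → ℕ) (G : (Fin s → ℝ) → ℝ) :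
    ∀ (l : List (Fin s)), l.Nodup → ∀ w : (Fin s → Fin (2 ^ m)) → ℝ,
    (∀ i ∈ l, ∀ j c, w (Function.update j i c) = w j) →
    ∑ j, w j * (l.map fun i => gridWal m (k i) (j i)).prod * G (gridPoint t j)
      = ∑ j, w j * walshOp m t k l G (gridPoint t j)
  | [], _, w, _ => by simp [walshOp]
  | i :: l, hl, w, hw => by
    have hl' := List.nodup_cons.1 hl
    have ih := sum_walshOp t k G l hl'.2 (fun j => w j * gridWal m (k i) (j i))
      (fun i' hi' j c => by
        have : i ≠ i' := fun h => hl'.1 (h ▸ hi')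
        simp [hw i' (List.mem_cons_of_mem _ hi'), this])
    simp only [List.map_cons, List.prod_cons, ← mul_assoc]
    rw [ih, sum_eq_sum_average_update (by positivity) i]
    refine Finset.sum_congr rfl fun j _ => ?_
    simp only [walshOp, hw i List.mem_cons_self, gridPoint_update, Function.update_self]
    rw [Finset.sum_range, mul_left_comm, Finset.mul_sum]
    push_cast
    simp only [mul_assoc, Finset.mul_sum]

/-- The Walsh coefficient of the restriction of `G` to the grid. -/
def walshCoeff (m : ℕ) {s : ℕ} (t : Fin s → ℕ → ℝ) (G : (Fin s → ℝ) → ℝ)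
    (k : Fin s → Fin (2 ^ m)) : ℝ :=
  1 / (2 ^ m) ^ s * ∑ j : Fin s → Fin (2 ^ m), (∏ i, gridWal m (k i) (j i)) * G (gridPoint t j)

/-- The set of coordinates where `k` does not vanish. -/
def indexSupport {m s : ℕ} (k : Fin s → Fin (2 ^ m)) : Finset (Fin s) :=
  Finset.univ.filter fun i => (k i : ℕ) ≠ 0

theorem gridPoint_mem_box {a b : ℕ → ℝ} {s N : ℕ} {t : Fin s → ℕ → ℝ}
    (ht : ∀ (i : Fin s) c, t i c ∈ Set.Icc (a i) (b i)) (j : Fin s → Fin N) :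
    gridPoint t j ∈ box a b s :=
  ⟨fun i => (ht i _).1, fun i => (ht i _).2⟩

theorem abs_walshCoeff_le {a b : ℕ → ℝ} {m s : ℕ} {t : Fin s → ℕ → ℝ}
    (ht : ∀ (i : Fin s) c, t i c ∈ Set.Icc (a i) (b i)) (htm : ∀ i, Monotone (t i))
    {F : (Fin s → ℝ) → ℝ} (hF : HasMixedPartials a b F) (k : Fin s → Fin (2 ^ m)) {M : ℝ}
    (hM : 0 ≤ M) (hb : ∀ x ∈ box a b s, |mixedPartial a b (indexSupport k) F x| ≤ M) :
    |walshCoeff m t F k|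
      ≤ M * ∏ i ∈ indexSupport k, ((b i - a i) * (1 / 2 ^ (k i : ℕ).size)) := by
  set u := indexSupport k with hu
  have hprod : ∀ j : Fin s → Fin (2 ^ m), ∏ i, gridWal m (k i) (j i)
      = ((descList u).map fun i => gridWal m (k i) (j i)).prod := by
    intro j
    rw [← List.prod_toFinset _ (descList_nodup u), descList_toFinset]
    refine (Finset.prod_subset (Finset.subset_univ u) fun i _ hi => ?_).symm
    have : (k i : ℕ) = 0 := by simpa [hu, indexSupport] using hi
    rw [this, gridWal_zero_left]
  have h := sum_walshOp (m := m) t (fun i => (k i : ℕ)) F (descList u) (descList_nodup u)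
    (fun _ => 1) (fun _ _ _ _ => rfl)
  simp only [one_mul] at h
  have hle := abs_walshOp_le (k := fun i => (k i : ℕ)) (m := m) ht htm (fun i => (k i).2) hM
    (descList_nodup u) (fun i hi => by
      have := mem_descList.1 hi
      simpa [hu, indexSupport] using this)
    (hF.partialDiffList (descList u) [] (by simpa using descList_pairwise u))
    (by rw [← partialDerivs_descList] at hb; exact hb)
  rw [← List.prod_toFinset _ (descList_nodup u), descList_toFinset] at hle
  rw [walshCoeff, Finset.sum_congr rfl fun j _ => by rw [hprod j], h, abs_mul,
    abs_of_pos (by positivity : (0 : ℝ) < 1 / (2 ^ m) ^ s)]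
  refine (mul_le_mul_of_nonneg_left (Finset.abs_sum_le_sum_abs _ _) (by positivity)).trans ?_
  refine (mul_le_mul_of_nonneg_left (Finset.sum_le_sum fun j _ =>
    hle _ (gridPoint_mem_box ht j)) (by positivity)).trans ?_
  rw [Finset.sum_const, Finset.card_univ, Fintype.card_fun, Fintype.card_fin, Fintype.card_fin,
    nsmul_eq_mul]
  push_cast
  rw [← mul_assoc, one_div_mul_cancel (by positivity), one_mul]

/-- Walsh inversion on the grid. -/
theorem sum_walshCoeff {m s : ℕ} (t : Fin s → ℕ → ℝ) (G : (Fin s → ℝ) → ℝ)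
    (j : Fin s → Fin (2 ^ m)) :
    G (gridPoint t j) = ∑ k, walshCoeff m t G k * ∏ i, gridWal m (k i) (j i) := by
  have horth : ∀ j' : Fin s → Fin (2 ^ m),
      ∑ k : Fin s → Fin (2 ^ m), (∏ i, gridWal m (k i) (j' i)) * ∏ i, gridWal m (k i) (j i)
        = if j' = j then (2 ^ m) ^ s else 0 := by
    intro j'
    simp only [← Finset.prod_mul_distrib]
    rw [← Fintype.prod_sum (fun i (c : Fin (2 ^ m)) => gridWal m c (j' i) * gridWal m c (j i))]
    have h1 : ∀ i, ∑ c : Fin (2 ^ m), gridWal m c (j' i) * gridWal m c (j i)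
        = if j' i = j i then 2 ^ m else 0 := by
      intro i
      rw [← Finset.sum_range (fun c => gridWal m c (j' i) * gridWal m c (j i)),
        sum_gridWal_mul (j' i).2 (j i).2]
      simp only [Fin.ext_iff]
    simp only [h1]
    split_ifs with h
    · subst h; simp
    · obtain ⟨i, hi⟩ := Function.ne_iff.1 h
      exact Finset.prod_eq_zero (Finset.mem_univ i) (if_neg hi)
  simp only [walshCoeff, mul_assoc, Finset.sum_mul]
  rw [← Finset.mul_sum, Finset.sum_comm]
  have : ∀ j' : Fin s → Fin (2 ^ m), ∑ k : Fin s → Fin (2 ^ m),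
      (∏ i, gridWal m (k i) (j' i)) * (G (gridPoint t j') * ∏ i, gridWal m (k i) (j i))
      = if j' = j then (2 ^ m) ^ s * G (gridPoint t j) else 0 := by
    intro j'
    rw [← Finset.sum_congr rfl fun k _ => mul_left_comm _ _ _, ← Finset.mul_sum, horth]
    split_ifs with h
    · rw [h, mul_comm]
    · rw [mul_zero]
  simp only [this, Finset.sum_ite_eq', Finset.mem_univ, if_true]
  rw [← mul_assoc, one_div_mul_cancel (by positivity), one_mul]

/-! ### Error of a rule with nodes on the grid against the average over the grid -/

theorem mem_indexSupport {m s : ℕ} {k : Fin s → Fin (2 ^ m)} {i : Fin s} :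
    i ∈ indexSupport k ↔ (k i : ℕ) ≠ 0 := by
  rw [indexSupport, Finset.mem_filter]
  exact and_iff_right (Finset.mem_univ i)

theorem indexSupport_eq_empty {m s : ℕ} {k : Fin s → Fin (2 ^ m)} :
    indexSupport k = ∅ ↔ k = 0 := by
  simp only [Finset.eq_empty_iff_forall_notMem, mem_indexSupport, not_not, funext_iff]
  exact forall_congr' fun i => (Fin.ext_iff (b := (0 : Fin (2 ^ m)))).symm

theorem sum_indexSupport_eq_walshSum {m s : ℕ} (J : Fin (2 ^ m) → Fin s → Fin (2 ^ m))
    (u : Finset (Fin s)) :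
    ∑ k : Fin s → Fin (2 ^ m) with indexSupport k = u,
      (∏ i ∈ u, (1 / 2 ^ (k i : ℕ).size : ℝ)) *
        |1 / 2 ^ m * ∑ n, ∏ i, gridWal m (k i) (J n i)|
    = walshSum m (fun n i => (J n i : ℝ) / 2 ^ m) u := by
  rw [walshSum]
  refine Finset.sum_bij' (fun k _ => fun i : u => (k i : ℕ))
    (fun κ hκ => fun i => if h : i ∈ u then
      ⟨κ ⟨i, h⟩, (Finset.mem_Ico.1 (Fintype.mem_piFinset.1 hκ ⟨i, h⟩)).2⟩ else 0) ?_ ?_ ?_ ?_ ?_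
  · intro k hk
    have hk := (Finset.mem_filter.1 hk).2
    refine Fintype.mem_piFinset.2 fun i => Finset.mem_Ico.2 ⟨?_, (k i).2⟩
    exact Nat.one_le_iff_ne_zero.2 (mem_indexSupport.1 (hk ▸ i.2))
  · intro κ hκ
    refine Finset.mem_filter.2 ⟨Finset.mem_univ _, ?_⟩
    ext i
    by_cases h : i ∈ u
    · have := (Finset.mem_Ico.1 (Fintype.mem_piFinset.1 hκ ⟨i, h⟩)).1
      simp only [mem_indexSupport, h, dif_pos, iff_true]
      omega
    · simp [mem_indexSupport, h]
  · intro k hk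
    have hk := (Finset.mem_filter.1 hk).2
    ext i
    by_cases h : i ∈ u
    · simp [h]
    · have : (k i : ℕ) = 0 := by
        rw [← hk, mem_indexSupport, not_not] at h; exact h
      simp [h, this]
  · intro κ hκ
    ext i
    simp
  · intro k hk
    have hk := (Finset.mem_filter.1 hk).2
    rw [one_div (2 ^ (∑ i : u, (k i : ℕ).size) : ℝ), ← Finset.prod_pow_eq_pow_sum,
      ← Finset.prod_inv_distrib]
    simp only [← one_div]
    rw [Finset.prod_coe_sort u (fun i => (1 / 2 ^ (k i : ℕ).size : ℝ))]
    congr 3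
    refine Finset.sum_congr rfl fun n _ => ?_
    simp only [wal_grid (k _).2]
    rw [Finset.prod_coe_sort u (fun i => gridWal m (k i) (J n i))]
    refine (Finset.prod_subset (Finset.subset_univ u) fun i _ hi => ?_).symm
    have : (k i : ℕ) = 0 := by
      rw [← hk, mem_indexSupport, not_not] at hi; exact hi
    rw [this, gridWal_zero_left]

theorem abs_rule_sub_gridAverage_le {a b : ℕ → ℝ} {m s : ℕ} {t : Fin s → ℕ → ℝ}
    (ht : ∀ (i : Fin s) c, t i c ∈ Set.Icc (a i) (b i)) (htm : ∀ i, Monotone (t i))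
    {F : (Fin s → ℝ) → ℝ} (hF : HasMixedPartials a b F) {M : Finset (Fin s) → ℝ}
    (hM : ∀ u, 0 ≤ M u) (hb : ∀ u, ∀ x ∈ box a b s, |mixedPartial a b u F x| ≤ M u)
    (J : Fin (2 ^ m) → Fin s → Fin (2 ^ m)) :
    |1 / 2 ^ m * ∑ n, F (gridPoint t (J n))
        - 1 / (2 ^ m) ^ s * ∑ j : Fin s → Fin (2 ^ m), F (gridPoint t j)|
      ≤ ∑ u : Finset (Fin s) with u.Nonempty,
          M u * (∏ i ∈ u, (b i - a i)) * walshSum m (fun n i => (J n i : ℝ) / 2 ^ m) u := by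
  set S : (Fin s → Fin (2 ^ m)) → ℝ :=
    fun k => 1 / 2 ^ m * ∑ n, ∏ i, gridWal m (k i) (J n i) with hS
  have h1 : 1 / 2 ^ m * ∑ n, F (gridPoint t (J n)) = ∑ k, walshCoeff m t F k * S k := by
    simp only [sum_walshCoeff t F (J _), hS]
    rw [Finset.sum_comm, Finset.mul_sum]
    refine Finset.sum_congr rfl fun k _ => ?_
    rw [← Finset.mul_sum]; ring
  have hS0 : S 0 = 1 := by simp [hS, gridWal_zero_left]
  have h2 : 1 / (2 ^ m) ^ s * ∑ j : Fin s → Fin (2 ^ m), F (gridPoint t j)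
      = walshCoeff m t F 0 := by
    simp [walshCoeff, gridWal_zero_left]
  have h3 : ∑ k, walshCoeff m t F k * S k
      = ∑ u : Finset (Fin s), ∑ k with indexSupport k = u, walshCoeff m t F k * S k :=
    (Finset.sum_fiberwise Finset.univ indexSupport _).symm
  have h4 : ∑ k : Fin s → Fin (2 ^ m) with indexSupport k = ∅, walshCoeff m t F k * S k
      = walshCoeff m t F 0 := by
    simp [indexSupport_eq_empty, Finset.filter_eq', hS0]
  have h5 : (Finset.univ.filter fun u : Finset (Fin s) => u.Nonempty) = Finset.univ.erase ∅ := by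
    ext u; simp [Finset.nonempty_iff_ne_empty]
  rw [h1, h2, h3, ← Finset.add_sum_erase _ _ (Finset.mem_univ ∅), h4, add_sub_cancel_left, h5]
  refine (Finset.abs_sum_le_sum_abs _ _).trans (Finset.sum_le_sum fun u _ => ?_)
  rw [← sum_indexSupport_eq_walshSum, Finset.mul_sum]
  refine (Finset.abs_sum_le_sum_abs _ _).trans (Finset.sum_le_sum fun k hk => ?_)
  have hk := (Finset.mem_filter.1 hk).2
  rw [abs_mul]
  refine (mul_le_mul_of_nonneg_right (abs_walshCoeff_le ht htm hF k (hM u)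
    (by rw [hk]; exact hb u)) (abs_nonneg _)).trans (le_of_eq ?_)
  rw [hk, Finset.prod_mul_distrib]
  ring

/-! ### Error of the average over the grid -/

theorem abs_sub_le_of_partialDiff {a b : ℕ → ℝ} {s : ℕ} {F : (Fin s → ℝ) → ℝ} {L : Fin s → ℝ}
    (hF : ∀ i, PartialDiff a b i F) (hL : ∀ i, ∀ x ∈ box a b s, |partialDeriv a b i F x| ≤ L i)
    {x y : Fin s → ℝ} (hx : x ∈ box a b s) (hy : y ∈ box a b s) :
    |F x - F y| ≤ ∑ i, L i * |x i - y i| := by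
  have hmem : ∀ u : Finset (Fin s), u.piecewise x y ∈ box a b s := fun u =>
    ⟨Finset.le_piecewise_of_le_of_le u hx.1 hy.1, Finset.piecewise_le_of_le_of_le u hx.2 hy.2⟩
  suffices h : ∀ u : Finset (Fin s), |F (u.piecewise x y) - F y| ≤ ∑ i ∈ u, L i * |x i - y i| by
    simpa using h Finset.univ
  intro u
  induction u using Finset.induction_on with
  | empty => simp
  | insert i u hi ih =>
    rw [Finset.sum_insert hi, Finset.piecewise_insert]
    set z := u.piecewise x y with hz
    have hzi : z i = y i := by simp [hz, hi]
    have hxi : x i ∈ Set.Icc (a i) (b i) := ⟨hx.1 i, hx.2 i⟩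
    have hyi : y i ∈ Set.Icc (a i) (b i) := ⟨hy.1 i, hy.2 i⟩
    have h1 := (convex_Icc (a i) (b i)).norm_image_sub_le_of_norm_hasDerivWithin_le
      (fun τ hτ => (hF i).hasDerivWithinAt (hmem u) hτ)
      (fun τ hτ => hL i _ (update_mem_box (hmem u) i hτ)) hyi hxi
    rw [← hz, ← hzi, Function.update_eq_self, hzi, Real.norm_eq_abs, Real.norm_eq_abs] at h1
    calc |F (Function.update z i (x i)) - F y|
        ≤ |F (Function.update z i (x i)) - F z| + |F z - F y| := abs_sub_le _ _ _
      _ ≤ _ := add_le_add h1 ih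

theorem continuousOn_of_partialDiff {a b : ℕ → ℝ} {s : ℕ} {F : (Fin s → ℝ) → ℝ} {L : Fin s → ℝ}
    (hF : ∀ i, PartialDiff a b i F)
    (hL : ∀ i, ∀ x ∈ box a b s, |partialDeriv a b i F x| ≤ L i) :
    ContinuousOn F (box a b s) := by
  intro y hy
  rw [ContinuousWithinAt, tendsto_iff_dist_tendsto_zero]
  have h0 : Filter.Tendsto (fun x : Fin s → ℝ => ∑ i, L i * |x i - y i|)
      (nhdsWithin y (box a b s)) (nhds 0) := by
    have : Continuous fun x : Fin s → ℝ => ∑ i, L i * |x i - y i| := by fun_prop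
    have := (this.tendsto y).mono_left (nhdsWithin_le_nhds (s := box a b s))
    simpa using this
  refine squeeze_zero' (Filter.Eventually.of_forall fun _ => dist_nonneg) ?_ h0
  filter_upwards [self_mem_nhdsWithin] with x hx
  exact abs_sub_le_of_partialDiff hF hL hx hy

open MeasureTheory

theorem box_eq_pi (a b : ℕ → ℝ) (s : ℕ) :
    box a b s = Set.univ.pi fun i : Fin s => Set.Icc (a i) (b i) :=
  (Set.pi_univ_Icc _ _).symm

theorem setIntegral_pi_prod {s : ℕ} (C : Fin s → Set ℝ) (φ : Fin s → ℝ → ℝ) :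
    ∫ x in Set.univ.pi C, ∏ i, φ i (x i) = ∏ i, ∫ y in C i, φ i y := by
  rw [volume_pi, Measure.restrict_pi_pi, integral_fintype_prod_eq_prod]

theorem exists_mem_Ioc_of_mem_Ioc {t : ℕ → ℝ} {N : ℕ} {x : ℝ} (hx : x ∈ Set.Ioc (t 0) (t N)) :
    ∃ c : Fin N, x ∈ Set.Ioc (t c) (t (c + 1)) := by
  induction N with
  | zero => exact absurd hx (by simp)
  | succ N ih =>
    by_cases h : x ≤ t N
    · obtain ⟨c, hc⟩ := ih ⟨hx.1, h⟩
      exact ⟨c.castSucc, hc⟩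
    · exact ⟨Fin.last N, not_le.1 h, hx.2⟩

theorem abs_gridAverage_sub_integral_le {a b : ℕ → ℝ} {s N : ℕ} (hN : N ≠ 0)
    {t : Fin s → ℕ → ℝ} (htm : ∀ i, Monotone (t i)) (ht0 : ∀ i : Fin s, t i 0 = a i)
    (htN : ∀ i : Fin s, t i N = b i) {φ : ℕ → ℝ → ℝ}
    (hφ0 : ∀ i : Fin s, ∀ x ∈ Set.Icc (a i) (b i), 0 ≤ φ i x)
    (hφi : ∀ i : Fin s, IntegrableOn (φ i) (Set.Icc (a i) (b i)))
    (hφt : ∀ (i : Fin s) (c : Fin N), ∫ y in Set.Ioc (t i c) (t i (c + 1)), φ i y = 1 / N)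
    {F : (Fin s → ℝ) → ℝ} {L : Fin s → ℝ}
    (hF : ∀ i, PartialDiff a b i F)
    (hL : ∀ i, ∀ x ∈ box a b s, |partialDeriv a b i F x| ≤ L i) :
    |1 / (N : ℝ) ^ s * ∑ j : Fin s → Fin N, F (gridPoint t j)
        - ∫ x in box a b s, F x * ∏ i : Fin s, φ i (x i)|
      ≤ ∑ i, L i * (b i - a i) * (1 / N) := by
  set g : (Fin s → ℝ) → ℝ := fun x => ∏ i : Fin s, φ i (x i) with hg
  have hNpos : (0 : ℝ) < N := by exact_mod_cast Nat.pos_of_ne_zero hN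
  have hgi : IntegrableOn g (box a b s) := by
    rw [IntegrableOn, box_eq_pi, volume_pi, Measure.restrict_pi_pi]
    exact Integrable.fintype_prod (f := fun i : Fin s => φ i) fun i => hφi i
  have hFc := continuousOn_of_partialDiff hF hL
  have hcomp : IsCompact (box a b s) := isCompact_Icc
  obtain ⟨K, hK⟩ := hcomp.exists_bound_of_continuousOn hFc
  have hmeas : MeasurableSet (box a b s) := measurableSet_Icc
  have hFgi : IntegrableOn (fun x => F x * g x) (box a b s) :=
    Integrable.bdd_mul (c := K) hgi (hFc.aestronglyMeasurable hmeas)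
      ((ae_restrict_iff' hmeas).2 (Filter.Eventually.of_forall hK))
  set cell : (Fin s → Fin N) → Set (Fin s → ℝ) :=
    fun j => Set.univ.pi fun i => Set.Ioc (t i (j i)) (t i (j i + 1)) with hcell
  have hcm : ∀ j, MeasurableSet (cell j) := fun j =>
    MeasurableSet.univ_pi fun i => measurableSet_Ioc
  have hunion : (⋃ j, cell j) = Set.univ.pi fun i : Fin s => Set.Ioc (a i) (b i) := by
    ext x
    simp only [Set.mem_iUnion, hcell, Set.mem_univ_pi]
    constructor
    · rintro ⟨j, hj⟩ i
      rw [← ht0, ← htN]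
      exact ⟨lt_of_le_of_lt (htm i (Nat.zero_le _)) (hj i).1,
        (hj i).2.trans (htm i (j i).2)⟩
    · intro hx
      have : ∀ i, ∃ c : Fin N, x i ∈ Set.Ioc (t i c) (t i (c + 1)) := fun i =>
        exists_mem_Ioc_of_mem_Ioc (by rw [ht0, htN]; exact hx i)
      choose j hj using this
      exact ⟨j, hj⟩
  have hdisj : Pairwise (Function.onFun Disjoint cell) := by
    intro j j' hjj
    obtain ⟨i, hi⟩ := Function.ne_iff.1 hjj
    refine Set.disjoint_univ_pi.2 ⟨i, ?_⟩
    exact (htm i).pairwise_disjoint_on_Ioc_succ (fun h => hi (Fin.ext h))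
  have hsub : ∀ j, cell j ⊆ box a b s := by
    intro j
    refine (Set.subset_iUnion cell j).trans ?_
    rw [hunion, box_eq_pi]
    exact Set.pi_mono fun i _ => Set.Ioc_subset_Icc_self
  have hae : (⋃ j, cell j) =ᵐ[volume] box a b s := by
    rw [hunion, volume_pi]
    exact Measure.univ_pi_Ioc_ae_eq_Icc
  have hint : ∫ x in box a b s, F x * g x = ∑ j, ∫ x in cell j, F x * g x := by
    rw [← setIntegral_congr_set hae]
    exact integral_iUnion_fintype hcm hdisj fun j => hFgi.mono_set (hsub j)
  have hcellg : ∀ j, ∫ x in cell j, g x = 1 / (N : ℝ) ^ s := by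
    intro j
    rw [hcell, hg, setIntegral_pi_prod (fun i => Set.Ioc (t i (j i)) (t i (j i + 1)))
      (fun i => φ i)]
    simp [hφt]
  have hgp : ∀ j : Fin s → Fin N, gridPoint t j ∈ box a b s := fun j =>
    ⟨fun i => (ht0 i).symm.trans_le (htm i (Nat.zero_le _)),
      fun i => (htm i (j i).2.le).trans_eq (htN i)⟩
  have hLi : ∀ i : Fin s, 0 ≤ L i := fun i =>
    (abs_nonneg _).trans (hL i _ (hgp fun _ => ⟨0, Nat.pos_of_ne_zero hN⟩))
  have hone : ∀ j, |1 / (N : ℝ) ^ s * F (gridPoint t j) - ∫ x in cell j, F x * g x|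
      ≤ 1 / (N : ℝ) ^ s * ∑ i, L i * (t i (j i + 1) - t i (j i)) := by
    intro j
    have hgc := hgi.mono_set (hsub j)
    have e1 : 1 / (N : ℝ) ^ s * F (gridPoint t j) - ∫ x in cell j, F x * g x
        = ∫ x in cell j, (F (gridPoint t j) * g x - F x * g x) := by
      rw [integral_sub (hgc.const_mul _) (hFgi.mono_set (hsub j)), integral_const_mul, hcellg,
        mul_comm]
    have e2 : 1 / (N : ℝ) ^ s * ∑ i, L i * (t i (j i + 1) - t i (j i))
        = ∫ x in cell j, (∑ i, L i * (t i (j i + 1) - t i (j i))) * g x := by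
      rw [integral_const_mul, hcellg, mul_comm]
    rw [e1, e2, ← Real.norm_eq_abs]
    refine norm_integral_le_of_norm_le (hgc.const_mul _) ?_
    refine (ae_restrict_iff' (hcm j)).2 (Filter.Eventually.of_forall fun x hx => ?_)
    have hxb := hsub j hx
    have hg0 : 0 ≤ g x := Finset.prod_nonneg fun i _ => hφ0 i _ ⟨hxb.1 i, hxb.2 i⟩
    rw [← sub_mul, Real.norm_eq_abs, abs_mul, abs_of_nonneg hg0]
    refine mul_le_mul_of_nonneg_right ?_ hg0
    refine (abs_sub_le_of_partialDiff hF hL (hgp j) hxb).trans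
      (Finset.sum_le_sum fun i _ => mul_le_mul_of_nonneg_left ?_ (hLi i))
    have hxi := hx i (Set.mem_univ i)
    rw [abs_sub_comm, gridPoint, abs_of_nonneg (sub_nonneg.2 hxi.1.le)]
    exact sub_le_sub_right hxi.2 _
  rw [hint, Finset.mul_sum, ← Finset.sum_sub_distrib]
  refine (Finset.abs_sum_le_sum_abs _ _).trans ((Finset.sum_le_sum fun j _ => hone j).trans ?_)
  rw [← Finset.mul_sum, Finset.sum_comm, Finset.mul_sum]
  refine le_of_eq (Finset.sum_congr rfl fun i _ => ?_)
  rw [← Finset.mul_sum, sum_eq_sum_average_update hN i]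
  simp only [Function.update_self]
  rw [← Finset.sum_range (fun c => t i (c + 1) - t i c), Finset.sum_range_sub, ht0, htN,
    Finset.sum_const, Finset.card_univ, Fintype.card_fun, Fintype.card_fin, Fintype.card_fin,
    nsmul_eq_mul]
  push_cast
  field_simp

/-! ### Quantiles of a density -/

section Density

open MeasureTheory

variable {a b : ℝ} {φ : ℝ → ℝ}

theorem IsInvertibleDensity.intervalIntegrable (h : IsInvertibleDensity a b φ) :
    IntervalIntegrable φ volume a b := by
  by_contra hn
  have := h.integral_eq_one
  rw [intervalIntegral.integral_undef hn] at this
  exact zero_ne_one this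

theorem IsInvertibleDensity.integral_Ioc (h : IsInvertibleDensity a b φ) {x y : ℝ}
    (hx : x ∈ Set.Icc a b) (hy : y ∈ Set.Icc a b) (hxy : x ≤ y) :
    ∫ z in Set.Ioc x y, φ z = cdf a φ y - cdf a φ x := by
  have hi : ∀ z ∈ Set.Icc a b, IntervalIntegrable φ volume a z := fun z hz =>
    h.intervalIntegrable.mono_set (by
      rw [Set.uIcc_of_le hz.1, Set.uIcc_of_le (hz.1.trans hz.2)]
      exact Set.Icc_subset_Icc_right hz.2)
  rw [cdf, cdf, intervalIntegral.integral_interval_sub_left (hi y hy) (hi x hx),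
    intervalIntegral.integral_of_le hxy]

theorem IsInvertibleDensity.cdf_mono (h : IsInvertibleDensity a b φ) {x y : ℝ}
    (hx : x ∈ Set.Icc a b) (hy : y ∈ Set.Icc a b) (hxy : x ≤ y) : cdf a φ x ≤ cdf a φ y := by
  rw [← sub_nonneg, ← h.integral_Ioc hx hy hxy]
  exact setIntegral_nonneg measurableSet_Ioc fun z hz =>
    h.nonneg z ⟨hx.1.trans hz.1.le, hz.2.trans hy.2⟩

theorem IsInvertibleDensity.invCdf_mem (h : IsInvertibleDensity a b φ) {y : ℝ}
    (hy : y ∈ Set.Icc (0 : ℝ) 1) : invCdf a b φ y ∈ Set.Icc a b :=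
  Function.invFunOn_mem (h.bijOn.surjOn hy)

theorem IsInvertibleDensity.cdf_invCdf (h : IsInvertibleDensity a b φ) {y : ℝ}
    (hy : y ∈ Set.Icc (0 : ℝ) 1) : cdf a φ (invCdf a b φ y) = y :=
  Function.invFunOn_eq (h.bijOn.surjOn hy)

theorem IsInvertibleDensity.invCdf_mono (h : IsInvertibleDensity a b φ) {x y : ℝ}
    (hx : x ∈ Set.Icc (0 : ℝ) 1) (hy : y ∈ Set.Icc (0 : ℝ) 1) (hxy : x ≤ y) :
    invCdf a b φ x ≤ invCdf a b φ y := by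
  by_contra hlt
  have h1 := h.cdf_mono (h.invCdf_mem hy) (h.invCdf_mem hx) (not_le.1 hlt).le
  rw [h.cdf_invCdf hx, h.cdf_invCdf hy] at h1
  exact hlt (by rw [le_antisymm hxy h1])

theorem IsInvertibleDensity.invCdf_zero (h : IsInvertibleDensity a b φ) (hab : a ≤ b) :
    invCdf a b φ 0 = a := by
  have h0 : (0 : ℝ) ∈ Set.Icc (0 : ℝ) 1 := by simp
  refine h.bijOn.injOn (h.invCdf_mem h0) ⟨le_rfl, hab⟩ ?_
  rw [h.cdf_invCdf h0, cdf, intervalIntegral.integral_same]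

theorem IsInvertibleDensity.invCdf_one (h : IsInvertibleDensity a b φ) (hab : a ≤ b) :
    invCdf a b φ 1 = b := by
  have h1 : (1 : ℝ) ∈ Set.Icc (0 : ℝ) 1 := by simp
  refine h.bijOn.injOn (h.invCdf_mem h1) ⟨hab, le_rfl⟩ ?_
  rw [h.cdf_invCdf h1, cdf, h.integral_eq_one]

end Density

/-- The quantile `Φ⁻¹(c / N)`, continued by `Φ⁻¹(1)` for `c > N`. -/
def quantile (a b : ℝ) (φ : ℝ → ℝ) (N c : ℕ) : ℝ := invCdf a b φ (min ((c : ℝ) / N) 1)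

theorem min_div_mem_Icc (N c : ℕ) : min ((c : ℝ) / N) 1 ∈ Set.Icc (0 : ℝ) 1 :=
  ⟨le_min (by positivity) zero_le_one, min_le_right _ _⟩

theorem quantile_of_le (a b : ℝ) (φ : ℝ → ℝ) {N c : ℕ} (hc : c ≤ N) :
    quantile a b φ N c = invCdf a b φ ((c : ℝ) / N) := by
  rw [quantile, min_eq_left]
  exact div_le_one_of_le₀ (by exact_mod_cast hc) (by positivity)

section Quantile

variable {a b : ℝ} {φ : ℝ → ℝ}

theorem IsInvertibleDensity.quantile_mem (h : IsInvertibleDensity a b φ) (N c : ℕ) :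
    quantile a b φ N c ∈ Set.Icc a b :=
  h.invCdf_mem (min_div_mem_Icc N c)

theorem IsInvertibleDensity.quantile_mono (h : IsInvertibleDensity a b φ) (N : ℕ) :
    Monotone (quantile a b φ N) := fun c d hcd =>
  h.invCdf_mono (min_div_mem_Icc N c) (min_div_mem_Icc N d) (by gcongr)

theorem IsInvertibleDensity.integral_quantile (h : IsInvertibleDensity a b φ) {N c : ℕ}
    (hc : c < N) : ∫ y in Set.Ioc (quantile a b φ N c) (quantile a b φ N (c + 1)), φ y = 1 / N := by
  have hN : (0 : ℝ) < N := by exact_mod_cast lt_of_le_of_lt (Nat.zero_le c) hc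
  have hm : ∀ d ≤ N, (d : ℝ) / N ∈ Set.Icc (0 : ℝ) 1 := fun d hd =>
    ⟨by positivity, div_le_one_of_le₀ (by exact_mod_cast hd) hN.le⟩
  rw [h.integral_Ioc (h.quantile_mem N c) (h.quantile_mem N _) (h.quantile_mono N (Nat.le_succ c)),
    quantile_of_le _ _ _ hc.le, quantile_of_le _ _ _ hc, h.cdf_invCdf (hm _ hc.le),
    h.cdf_invCdf (hm _ hc)]
  push_cast
  field_simp
  ring

end Quantile

/-! ### The worst-case error of a rule with nodes on the dyadic grid -/

theorem abs_mixedPartial_le {a b : ℕ → ℝ} {γ : Finset ℕ → ℝ≥0} {s : ℕ} {F : (Fin s → ℝ) → ℝ}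
    (hF : supNorm a b γ F ≤ 1) (u : Finset (Fin s)) {x : Fin s → ℝ} (hx : x ∈ box a b s) :
    |mixedPartial a b u F x| ≤ weight γ u := by
  have h1 := (iSup_le_iff.1 hF) u
  rw [ENNReal.div_le_iff_le_mul (Or.inr ENNReal.one_ne_top) (Or.inl ENNReal.coe_ne_top),
    one_mul] at h1
  have h2 := (iSup₂_le_iff.1 h1) x hx
  rw [enorm_eq_nnnorm] at h2
  exact_mod_cast ENNReal.coe_le_coe.1 h2

theorem HasMixedPartials.partialDiff {a b : ℕ → ℝ} {s : ℕ} {F : (Fin s → ℝ) → ℝ}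
    (hF : HasMixedPartials a b F) (i : Fin s) : PartialDiff a b i F := fun x hx => by
  simpa [mixedPartial] using hF ∅ i (by simp) x hx

theorem wce_le {a b : ℕ → ℝ} (hab : ∀ i, a i < b i) {φ : ℕ → ℝ → ℝ}
    (hφ : ∀ i, IsInvertibleDensity (a i) (b i) (φ i)) (γ : Finset ℕ → ℝ≥0) {m s : ℕ}
    (J : Fin (2 ^ m) → Fin s → Fin (2 ^ m)) :
    wce a b φ γ (fun n i => (J n i : ℝ) / 2 ^ m)
      ≤ ENNReal.ofReal (∑ i : Fin s, (weight γ {i} : ℝ) * (b i - a i) * (1 / 2 ^ m)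
          + ∑ u : Finset (Fin s) with u.Nonempty, (weight γ u : ℝ) * (∏ i ∈ u, (b i - a i)) *
              walshSum m (fun n i => (J n i : ℝ) / 2 ^ m) u) := by
  refine iSup_le fun F => iSup_le fun hF => iSup_le fun hF1 => ENNReal.ofReal_le_ofReal ?_
  set t : Fin s → ℕ → ℝ := fun i => quantile (a i) (b i) (φ i) (2 ^ m) with ht
  have h1 := abs_rule_sub_gridAverage_le (fun i c => (hφ i).quantile_mem (2 ^ m) c)
    (fun i : Fin s => (hφ i).quantile_mono (2 ^ m)) hF (fun u => (weight γ u).coe_nonneg)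
    (fun u x hx => abs_mixedPartial_le hF1 u hx) J
  have h2 := abs_gridAverage_sub_integral_le (a := a) (b := b) (φ := φ) (t := t)
    (N := 2 ^ m) (by positivity)
    (fun i : Fin s => (hφ i).quantile_mono (2 ^ m))
    (fun i => by simp [ht, quantile, (hφ i).invCdf_zero (hab i).le])
    (fun i => by
      simp only [ht]
      rw [quantile_of_le _ _ _ le_rfl, div_self (by positivity), (hφ i).invCdf_one (hab i).le])
    (fun i => (hφ i).nonneg)
    (fun i => (intervalIntegrable_iff_integrableOn_Icc_of_le (hab i).le).1
      (hφ i).intervalIntegrable)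
    (fun i c => (hφ i).integral_quantile c.2)
    hF.partialDiff
    (fun i x hx => by simpa [mixedPartial] using abs_mixedPartial_le hF1 {i} hx)
  have h3 : err a b φ (fun n i => (J n i : ℝ) / 2 ^ m) F
      = (1 / 2 ^ m * ∑ n, F (gridPoint t (J n))
        - 1 / (2 ^ m) ^ s * ∑ j : Fin s → Fin (2 ^ m), F (gridPoint t j))
        + (1 / (2 ^ m) ^ s * ∑ j : Fin s → Fin (2 ^ m), F (gridPoint t j)
          - ∫ x in box a b s, F x * ∏ i : Fin s, φ i (x i)) := by
    have : ∀ n, gridPoint t (J n)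
        = fun i : Fin s => invCdf (a i) (b i) (φ i) ((J n i : ℝ) / 2 ^ m) := fun n => by
      ext i
      simp only [gridPoint, ht]
      rw [quantile_of_le _ _ _ (J n i).2.le]
      push_cast
      rfl
    simp only [err, this]
    push_cast
    ring
  push_cast at h2
  rw [h3, add_comm (∑ i : Fin s, _)]
  exact (abs_add_le _ _).trans (add_le_add h1 h2)

/-! ### Integers and polynomials over `𝔽₂` -/

theorem coeff_natToPoly (n i : ℕ) : (natToPoly n).coeff i = if n.testBit i then 1 else 0 := by
  rw [natToPoly, Polynomial.finsetSum_coeff]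
  have h : ∀ j ∈ Finset.range n.size,
      (if n.testBit j then (Polynomial.X ^ j : (ZMod 2)[X]) else 0).coeff i
        = if j = i then (if n.testBit i then 1 else 0) else 0 := by
    intro j _
    by_cases hj : j = i
    · subst hj; rw [if_pos rfl]; split_ifs <;> simp
    · rw [if_neg hj]; split_ifs <;> simp [Polynomial.coeff_X_pow, Ne.symm hj]
  rw [Finset.sum_congr rfl h, Finset.sum_ite_eq']
  split_ifs with h1 h2 h2
  · rfl
  · rfl
  · exact absurd (Nat.testBit_eq_false_of_lt (Nat.size_le.1 (by simpa using h1))) (by simp [h2])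
  · rfl

theorem natToPoly_xor (n l : ℕ) : natToPoly (n ^^^ l) = natToPoly n + natToPoly l := by
  ext i
  rw [Polynomial.coeff_add, coeff_natToPoly, coeff_natToPoly, coeff_natToPoly, Nat.testBit_xor]
  cases n.testBit i <;> cases l.testBit i <;> rfl

theorem natToPoly_injective : Function.Injective natToPoly := by
  intro n l h
  refine Nat.eq_of_testBit_eq fun i => ?_
  have := congrArg (fun p => Polynomial.coeff p i) h
  simp only [coeff_natToPoly] at this
  cases hn : n.testBit i <;> cases hl : l.testBit i <;> simp_all

theorem natToPoly_zero : natToPoly 0 = 0 := by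
  ext i; simp [coeff_natToPoly]

theorem degree_natToPoly_lt {m n : ℕ} (h : n < 2 ^ m) : (natToPoly n).degree < m := by
  rw [Polynomial.degree_lt_iff_coeff_zero]
  intro i hi
  rw [coeff_natToPoly, Nat.testBit_eq_false_of_lt
    (h.trans_le (Nat.pow_le_pow_right (by norm_num) hi))]
  rfl

theorem exists_natToPoly_eq {m : ℕ} {h : (ZMod 2)[X]} (hh : h.degree < m) :
    ∃ n < 2 ^ m, natToPoly n = h := by
  refine ⟨Nat.ofBits fun i : Fin m => decide (h.coeff i = 1), Nat.ofBits_lt_two_pow _, ?_⟩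
  ext i
  rw [coeff_natToPoly]
  by_cases hi : i < m
  · rw [Nat.testBit_ofBits_lt _ _ hi]
    generalize h.coeff (⟨i, hi⟩ : Fin m) = z
    revert z
    decide
  · rw [Nat.testBit_ofBits_ge _ _ (not_lt.1 hi),
      Polynomial.coeff_eq_zero_of_degree_lt (hh.trans_le (by exact_mod_cast not_lt.1 hi))]
    rfl

/-! ### Laurent series -/

theorem toLaurent_X_pow (i : ℕ) :
    toLaurent (Polynomial.X ^ i) = HahnSeries.single (-(i : ℤ)) (1 : ZMod 2) := by
  simp [toLaurent, HahnSeries.single_pow]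

theorem coeff_toLaurent (P : (ZMod 2)[X]) (n : ℤ) :
    (toLaurent P).coeff n = if n ≤ 0 then P.coeff (-n).toNat else 0 := by
  induction P using Polynomial.induction_on' with
  | add p q hp hq =>
    rw [map_add, HahnSeries.coeff_add, hp, hq, Polynomial.coeff_add]
    split_ifs <;> simp
  | monomial i r =>
    rw [← Polynomial.C_mul_X_pow_eq_monomial, map_mul, toLaurent_X_pow,
      Polynomial.coeff_C_mul, Polynomial.coeff_X_pow]
    have : toLaurent (Polynomial.C r) = HahnSeries.C r := by simp [toLaurent]
    rw [this, HahnSeries.C_apply, HahnSeries.single_mul_single, HahnSeries.coeff_single]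
    simp only [zero_add, mul_one]
    split_ifs <;> first | omega | simp

theorem toLaurent_ne_zero {P : (ZMod 2)[X]} (hP : P ≠ 0) : toLaurent P ≠ 0 := by
  intro h
  refine hP (Polynomial.ext fun i => ?_)
  have := congrArg (fun x => HahnSeries.coeff x (-(i : ℤ))) h
  simpa [coeff_toLaurent] using this

theorem order_toLaurent {P : (ZMod 2)[X]} (hP : P ≠ 0) :
    (toLaurent P).order = -(P.natDegree : ℤ) := by
  refine le_antisymm (HahnSeries.order_le_of_coeff_ne_zero ?_)
    ((HahnSeries.le_order_iff_forall (toLaurent_ne_zero hP)).2 fun j hj => ?_)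
  · simpa [coeff_toLaurent] using hP
  · rw [coeff_toLaurent]
    split_ifs
    · exact Polynomial.coeff_eq_zero_of_natDegree_lt (by omega)
    · rfl

theorem coeff_div_order_ne_zero {P f : (ZMod 2)[X]} (hP : P ≠ 0) (hf : f ≠ 0) :
    (toLaurent P / toLaurent f).coeff ((f.natDegree : ℤ) - P.natDegree) ≠ 0 := by
  have hq : toLaurent P / toLaurent f ≠ 0 :=
    div_ne_zero (toLaurent_ne_zero hP) (toLaurent_ne_zero hf)
  have h : (toLaurent P / toLaurent f).order = (f.natDegree : ℤ) - P.natDegree := by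
    have := HahnSeries.order_mul hq (toLaurent_ne_zero hf)
    rw [div_mul_cancel₀ _ (toLaurent_ne_zero hf), order_toLaurent hP, order_toLaurent hf] at this
    omega
  rw [← h]
  exact fun h0 => hq (HahnSeries.coeff_order_eq_zero.1 h0)

/-- The nontrivial additive character of `𝔽₂`. -/
def signChar (z : ZMod 2) : ℝ := if z = 1 then -1 else 1

theorem signChar_zero : signChar 0 = 1 := by simp [signChar]

theorem signChar_one : signChar 1 = -1 := by simp [signChar]

theorem zmod_two_cases (z : ZMod 2) : z = 0 ∨ z = 1 := by
  revert z; decide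

theorem signChar_add (y z : ZMod 2) : signChar (y + z) = signChar y * signChar z := by
  have h : (1 + 1 : ZMod 2) = 0 := by decide
  rcases zmod_two_cases y with rfl | rfl <;> rcases zmod_two_cases z with rfl | rfl <;>
    simp [signChar_zero, signChar_one, h]

theorem signChar_sum {ι : Type*} (u : Finset ι) (z : ι → ZMod 2) :
    signChar (∑ i ∈ u, z i) = ∏ i ∈ u, signChar (z i) := by
  classical
  induction u using Finset.induction_on with
  | empty => simp [signChar_zero]
  | insert i u hi ih => rw [Finset.sum_insert hi, Finset.prod_insert hi, signChar_add, ih]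

/-! ### The digits of the points of a polynomial lattice -/

/-- The integer `2^m {L}_m`. -/
def fracIndex (m : ℕ) (L : LaurentSeries (ZMod 2)) : ℕ :=
  Nat.ofBits fun i : Fin m => decide (L.coeff ((m : ℤ) - i) = 1)

theorem fracIndex_lt (m : ℕ) (L : LaurentSeries (ZMod 2)) : fracIndex m L < 2 ^ m :=
  Nat.ofBits_lt_two_pow _

theorem testBit_fracIndex {m i : ℕ} (hi : i < m) (L : LaurentSeries (ZMod 2)) :
    (fracIndex m L).testBit (m - 1 - i) = decide (L.coeff ((i : ℤ) + 1) = 1) := by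
  have h : (m : ℤ) - ((m - 1 - i : ℕ) : ℤ) = i + 1 := by omega
  rw [fracIndex, Nat.testBit_ofBits_lt _ _ (by omega)]
  simp only [h]

theorem ofBits_eq_sum {m : ℕ} (c : Fin m → Bool) :
    Nat.ofBits c = ∑ i, (c i).toNat * 2 ^ (i : ℕ) := by
  induction m with
  | zero => simp
  | succ m ih =>
    rw [Nat.ofBits_succ, ih, Fin.sum_univ_succ, Finset.mul_sum, add_comm]
    congr 1
    · simp
    · refine Finset.sum_congr rfl fun i _ => ?_
      simp only [Function.comp_apply, Fin.val_succ, pow_succ]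
      ring

theorem fracPart_eq (m : ℕ) (L : LaurentSeries (ZMod 2)) :
    fracPart m L = (fracIndex m L : ℝ) / 2 ^ m := by
  have hv : ∀ z : ZMod 2, z.val = (decide (z = 1)).toNat := by decide
  rw [fracPart, fracIndex, ofBits_eq_sum,
    Fin.sum_univ_eq_sum_range
      (fun i => (decide (L.coeff ((m : ℤ) - i) = 1)).toNat * 2 ^ i) m,
    ← Finset.sum_range_reflect, Nat.cast_sum, Finset.sum_div,
    show Finset.Icc 1 m = Finset.Ico (0 + 1) (m + 1) from rfl,
    ← Finset.sum_Ico_add' (fun k : ℕ => ((L.coeff (k : ℤ)).val : ℝ) / 2 ^ k) 0 m 1,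
    ← Finset.range_eq_Ico]
  refine Finset.sum_congr rfl fun i hi => ?_
  have hi := Finset.mem_range.1 hi
  have h : (m : ℤ) - ((m - 1 - i : ℕ) : ℤ) = (i + 1 : ℕ) := by omega
  rw [h, hv]
  obtain ⟨j, rfl⟩ : ∃ j, m = (i + 1) + j := ⟨m - (i + 1), by omega⟩
  have e : i + 1 + j - 1 - i = j := by omega
  rw [e, pow_add]
  push_cast
  rw [pow_add]
  field_simp
  ring

theorem gridWal_fracIndex {m k : ℕ} (hk : k < 2 ^ m) (L : LaurentSeries (ZMod 2)) :
    gridWal m k (fracIndex m L) = signChar ((toLaurent (natToPoly k) * L).coeff 1) := by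
  have h1 : natToPoly k
      = ∑ i ∈ Finset.range m, Polynomial.C (if k.testBit i then 1 else 0) * Polynomial.X ^ i := by
    ext j
    simp only [Polynomial.finsetSum_coeff, Polynomial.coeff_C_mul, Polynomial.coeff_X_pow,
      mul_ite, mul_one, mul_zero, Finset.sum_ite_eq]
    rw [coeff_natToPoly]
    split_ifs with h2 h3 h3
    · rfl
    · exact absurd (Nat.testBit_eq_false_of_lt (hk.trans_le
        (Nat.pow_le_pow_right (by norm_num) (by simpa using h3)))) (by simp [h2])
    · rfl
    · rfl
  have h2 : (toLaurent (natToPoly k) * L).coeff 1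
      = ∑ i ∈ Finset.range m, if k.testBit i then L.coeff ((i : ℤ) + 1) else 0 := by
    rw [h1, map_sum, Finset.sum_mul, HahnSeries.coeff_sum]
    refine Finset.sum_congr rfl fun i _ => ?_
    rw [map_mul, toLaurent_X_pow]
    split_ifs
    · rw [map_one, map_one, one_mul]
      have := HahnSeries.coeff_single_mul_add (r := (1 : ZMod 2)) (x := L) (a := (i : ℤ) + 1)
        (b := -(i : ℤ))
      rwa [one_mul, add_neg_cancel_comm] at this
    · simp
  rw [h2, signChar_sum, gridWal]
  refine Finset.prod_congr rfl fun i hi => ?_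
  rw [testBit_fracIndex (Finset.mem_range.1 hi)]
  cases k.testBit i
  · simp [signChar_zero]
  · simp [signChar]

/-! ### Character sums over polynomial lattices -/

theorem sum_signChar_eq_zero {m : ℕ} {f K : (ZMod 2)[X]} (hf : Irreducible f)
    (hm : f.natDegree = m) (hK : ¬ f ∣ K) :
    ∑ n ∈ Finset.range (2 ^ m),
      signChar ((toLaurent (natToPoly n * K) / toLaurent f).coeff 1) = 0 := by
  have hm0 : 0 < m := hm ▸ hf.natDegree_pos
  have hf0 := hf.ne_zero
  obtain ⟨c, e, hce⟩ := (hf.coprime_iff_not_dvd.2 hK).symm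
  set h := (Polynomial.X ^ (m - 1) * c) % f with hh
  have hdeg : h.degree < m := by
    have := EuclideanDomain.mod_lt (Polynomial.X ^ (m - 1) * c) hf0
    rw [← hh] at this
    exact (lt_of_lt_of_eq this (by rw [Polynomial.degree_eq_natDegree hf0, hm]))
  obtain ⟨l, hl, hlh⟩ := exists_natToPoly_eq hdeg
  obtain ⟨q, hq⟩ : ∃ q, h * K = Polynomial.X ^ (m - 1) + f * q := by
    have h1 := EuclideanDomain.div_add_mod (Polynomial.X ^ (m - 1) * c) f
    rw [← hh] at h1
    refine ⟨-(Polynomial.X ^ (m - 1) * e) - ((Polynomial.X ^ (m - 1) * c) / f) * K, ?_⟩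
    linear_combination K * h1 + Polynomial.X ^ (m - 1) * hce
  have hcoeff : (toLaurent (h * K) / toLaurent f).coeff 1 = 1 := by
    rw [hq, map_add, map_mul, add_div, mul_div_cancel_left₀ _ (toLaurent_ne_zero hf0),
      HahnSeries.coeff_add, coeff_toLaurent q 1]
    have h1 := coeff_div_order_ne_zero (P := Polynomial.X ^ (m - 1)) (f := f)
      (pow_ne_zero _ Polynomial.X_ne_zero) hf0
    rw [Polynomial.natDegree_X_pow, hm, show (m : ℤ) - ((m - 1 : ℕ) : ℤ) = 1 by omega] at h1
    rw [(zmod_two_cases _).resolve_left h1]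
    simp
  refine sum_eq_zero_of_xor_neg hl _ fun n _ => ?_
  rw [natToPoly_xor, add_mul, map_add, add_div, HahnSeries.coeff_add, signChar_add, hlh, hcoeff,
    signChar_one, mul_neg_one]

/-! ### The figure of merit as a sum over sets of natural numbers -/

/-- `walshSum` of a polynomial lattice for a set of coordinates given as a set of integers. -/
def latticeSum (m : ℕ) (f : (ZMod 2)[X]) (g : ℕ → (ZMod 2)[X]) (U : Finset ℕ) : ℝ :=
  ∑ k ∈ Fintype.piFinset (fun _ : U => Finset.Ico 1 (2 ^ m)),
    (1 / 2 ^ (∑ i, (k i).size)) * |(1 / 2 ^ m) * ∑ n : Fin (2 ^ m),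
      ∏ i : U, wal (k i) (fracPart m (toLaurent (natToPoly n * g i) / toLaurent f))|

theorem walshSum_polyLattice (m s : ℕ) (f : (ZMod 2)[X]) (g : ℕ → (ZMod 2)[X])
    (u : Finset (Fin s)) :
    walshSum m (polyLattice m s f g) u = latticeSum m f g (u.map Fin.valEmbedding) := by
  rw [walshSum, latticeSum]
  let e : u ≃ (u.map Fin.valEmbedding : Finset ℕ) := u.equivMap Fin.valEmbedding
  have he : ∀ i : u, ((e i : ℕ)) = ((i : Fin s) : ℕ) := fun i => rfl
  refine Finset.sum_equiv (Equiv.arrowCongr e (Equiv.refl ℕ)) ?_ ?_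
  · intro k
    simp only [Fintype.mem_piFinset]
    constructor
    · intro h i; exact h (e.symm i)
    · intro h i; simpa using h (e i)
  · intro k _
    have h1 : ∑ i, ((Equiv.arrowCongr e (Equiv.refl ℕ)) k i).size = ∑ i, (k i).size :=
      (Fintype.sum_equiv e _ _ fun i => by simp).symm
    rw [h1]
    congr 3
    refine Finset.sum_congr rfl fun n _ => Fintype.prod_equiv e _ _ fun i => ?_
    simp [polyLattice, he]

theorem sum_finset_fin {s : ℕ} (h : Finset ℕ → ℝ) :
    ∑ u : Finset (Fin s) with u.Nonempty, h (u.map Fin.valEmbedding)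
      = ∑ U ∈ (Finset.range s).powerset with U.Nonempty, h U := by
  refine Finset.sum_bij (fun u _ => u.map Fin.valEmbedding) ?_ ?_ ?_ ?_
  · intro u hu
    simp only [Finset.mem_filter, Finset.mem_univ, true_and] at hu
    simp only [Finset.mem_filter, Finset.mem_powerset, Finset.map_nonempty, hu, and_true]
    intro i hi
    obtain ⟨j, _, rfl⟩ := Finset.mem_map.1 hi
    exact Finset.mem_range.2 j.2
  · intro u _ v _ huv
    exact Finset.map_injective _ huv
  · intro U hU
    simp only [Finset.mem_filter, Finset.mem_powerset] at hU
    have hlt : ∀ i ∈ U, i < s := fun i hi => Finset.mem_range.1 (hU.1 hi)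
    have hmap : (U.attachFin hlt).map Fin.valEmbedding = U := Finset.map_valEmbedding_attachFin hlt
    refine ⟨U.attachFin hlt, ?_, hmap⟩
    simp only [Finset.mem_filter, Finset.mem_univ, true_and]
    rw [← Finset.map_nonempty (f := Fin.valEmbedding), hmap]
    exact hU.2
  · intro u _; rfl

theorem figureOfMerit_eq (a b : ℕ → ℝ) (γ : Finset ℕ → ℝ≥0) (m s : ℕ) (f : (ZMod 2)[X])
    (g : ℕ → (ZMod 2)[X]) :
    figureOfMerit a b γ m s f g = ∑ U ∈ (Finset.range s).powerset with U.Nonempty,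
      (γ U : ℝ) * (∏ i ∈ U, (b i - a i)) * latticeSum m f g U := by
  rw [figureOfMerit, ← sum_finset_fin]
  refine Finset.sum_congr rfl fun u _ => ?_
  rw [walshSum_polyLattice, weight, Finset.prod_map]
  rfl

theorem latticeSum_congr (m : ℕ) (f : (ZMod 2)[X]) {g g' : ℕ → (ZMod 2)[X]} {U : Finset ℕ}
    (h : ∀ i ∈ U, g i = g' i) : latticeSum m f g U = latticeSum m f g' U := by
  simp only [latticeSum, fun i : U => h i i.2]

theorem figureOfMerit_congr (a b : ℕ → ℝ) (γ : Finset ℕ → ℝ≥0) (m : ℕ) {s : ℕ}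
    (f : (ZMod 2)[X]) {g g' : ℕ → (ZMod 2)[X]} (h : ∀ i < s, g i = g' i) :
    figureOfMerit a b γ m s f g = figureOfMerit a b γ m s f g' := by
  rw [figureOfMerit_eq, figureOfMerit_eq]
  refine Finset.sum_congr rfl fun U hU => ?_
  simp only [Finset.mem_filter, Finset.mem_powerset] at hU
  rw [latticeSum_congr m f fun i hi => h i (Finset.mem_range.1 (hU.1 hi))]

theorem sum_powerset_range_succ_nonempty (d : ℕ) (h : Finset ℕ → ℝ) :
    ∑ U ∈ (Finset.range (d + 1)).powerset with U.Nonempty, h U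
      = ∑ U ∈ (Finset.range d).powerset with U.Nonempty, h U
        + ∑ V ∈ (Finset.range d).powerset, h (insert d V) := by
  rw [Finset.sum_filter, Finset.sum_filter, Finset.range_add_one,
    Finset.sum_powerset_insert (by simp)]
  simp

/-! ### Bounds for the component-by-component construction -/

theorem prod_wal_eq_signChar {m : ℕ} {f : (ZMod 2)[X]} {U : Finset ℕ} {k : U → ℕ}
    (hk : k ∈ Fintype.piFinset (fun _ : U => Finset.Ico 1 (2 ^ m))) (g : ℕ → (ZMod 2)[X])
    (p : (ZMod 2)[X]) :
    ∏ i : U, wal (k i) (fracPart m (toLaurent (p * g i) / toLaurent f))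
      = signChar ((toLaurent (p * ∑ i : U, natToPoly (k i) * g i) / toLaurent f).coeff 1) := by
  rw [Finset.mul_sum, map_sum, Finset.sum_div, HahnSeries.coeff_sum, signChar_sum]
  refine Finset.prod_congr rfl fun i _ => ?_
  have hki := (Finset.mem_Ico.1 (Fintype.mem_piFinset.1 hk i)).2
  rw [fracPart_eq, wal_grid hki, gridWal_fracIndex hki, mul_left_comm, map_mul _ (natToPoly _),
    mul_div_assoc]

theorem abs_signChar (z : ZMod 2) : |signChar z| = 1 := by
  rw [signChar]; split_ifs <;> simp

theorem abs_mean_le_one {m : ℕ} {f : (ZMod 2)[X]} {U : Finset ℕ} {k : U → ℕ}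
    (hk : k ∈ Fintype.piFinset (fun _ : U => Finset.Ico 1 (2 ^ m))) (g : ℕ → (ZMod 2)[X]) :
    |(1 / 2 ^ m) * ∑ n : Fin (2 ^ m),
      ∏ i : U, wal (k i) (fracPart m (toLaurent (natToPoly n * g i) / toLaurent f))| ≤ 1 := by
  simp only [prod_wal_eq_signChar hk g]
  rw [abs_mul, abs_of_pos (by positivity : (0 : ℝ) < 1 / 2 ^ m)]
  refine (mul_le_mul_of_nonneg_left (Finset.abs_sum_le_sum_abs _ _) (by positivity)).trans ?_
  simp [abs_signChar]

theorem mean_eq_zero {m : ℕ} {f : (ZMod 2)[X]} (hf : Irreducible f) (hm : f.natDegree = m)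
    {U : Finset ℕ} {k : U → ℕ}
    (hk : k ∈ Fintype.piFinset (fun _ : U => Finset.Ico 1 (2 ^ m))) (g : ℕ → (ZMod 2)[X])
    (hd : ¬ f ∣ ∑ i : U, natToPoly (k i) * g i) :
    (1 / 2 ^ m : ℝ) * ∑ n : Fin (2 ^ m),
      ∏ i : U, wal (k i) (fracPart m (toLaurent (natToPoly n * g i) / toLaurent f)) = 0 := by
  simp only [prod_wal_eq_signChar hk g]
  rw [← Finset.sum_range (fun n => signChar
    ((toLaurent (natToPoly n * ∑ i : U, natToPoly (k i) * g i) / toLaurent f).coeff 1)),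
    sum_signChar_eq_zero hf hm hd, mul_zero]

theorem not_dvd_natToPoly {m : ℕ} {f : (ZMod 2)[X]} (hf : Irreducible f)
    (hm : f.natDegree = m) {k : ℕ} (h0 : k ≠ 0) (hk : k < 2 ^ m) : ¬ f ∣ natToPoly k := by
  intro h
  refine h0 (natToPoly_injective ?_)
  rw [natToPoly_zero]
  refine Polynomial.eq_zero_of_dvd_of_degree_lt h ?_
  rw [Polynomial.degree_eq_natDegree hf.ne_zero, hm]
  exact degree_natToPoly_lt hk

theorem sum_size (m : ℕ) : ∑ k ∈ Finset.Ico 1 (2 ^ m), (1 / 2 ^ k.size : ℝ) = m / 2 := by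
  induction m with
  | zero => simp
  | succ m ih =>
    rw [← Finset.sum_Ico_consecutive _ (Nat.one_le_two_pow (n := m))
      (Nat.pow_le_pow_right (by norm_num) (Nat.le_succ m)), ih,
      Finset.sum_congr rfl (g := fun _ => (1 / 2 ^ (m + 1) : ℝ))]
    · rw [Finset.sum_const, Nat.card_Ico, nsmul_eq_mul, pow_succ, mul_two, Nat.add_sub_cancel]
      push_cast
      field_simp
      ring
    · intro k hk
      obtain ⟨h1, h2⟩ := Finset.mem_Ico.1 hk
      have : k.size = m + 1 := le_antisymm (Nat.size_le.2 h2) (Nat.lt_size.2 h1)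
      rw [this]

theorem sum_piFinset_size (m : ℕ) (U : Finset ℕ) :
    ∑ k ∈ Fintype.piFinset (fun _ : U => Finset.Ico 1 (2 ^ m)),
      (1 / 2 ^ (∑ i, (k i).size) : ℝ) = (m / 2) ^ U.card := by
  have h : ∀ k : U → ℕ, (1 / 2 ^ (∑ i, (k i).size) : ℝ) = ∏ i, (1 / 2 ^ (k i).size) := fun k => by
    rw [← Finset.prod_pow_eq_pow_sum, one_div, ← Finset.prod_inv_distrib]
    simp only [one_div]
  simp only [h]
  rw [← Finset.prod_univ_sum (fun _ : U => Finset.Ico 1 (2 ^ m))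
    (fun (_ : U) (k : ℕ) => (1 / 2 ^ k.size : ℝ))]
  rw [Finset.prod_const, sum_size, Finset.card_univ, Fintype.card_coe]

theorem latticeSum_singleton_eq_zero {m : ℕ} {f : (ZMod 2)[X]} (hf : Irreducible f)
    (hm : f.natDegree = m) {g : ℕ → (ZMod 2)[X]} {i : ℕ} (hg : g i = 1) :
    latticeSum m f g {i} = 0 := by
  refine Finset.sum_eq_zero fun k hk => ?_
  rw [mean_eq_zero hf hm hk, abs_zero, mul_zero]
  have hki := Finset.mem_Ico.1 (Fintype.mem_piFinset.1 hk ⟨i, Finset.mem_singleton_self i⟩)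
  have h1 : ∑ j : ({i} : Finset ℕ), natToPoly (k j) * g j
      = natToPoly (k ⟨i, Finset.mem_singleton_self i⟩) := by
    rw [Fintype.sum_unique]
    change natToPoly (k ⟨i, _⟩) * g i = _
    rw [hg, mul_one]
  rw [h1]
  exact not_dvd_natToPoly hf hm (by omega) hki.2

/-- The average of `latticeSum` over the possible choices of one component. -/
theorem sum_latticeSum_update_le {m : ℕ} {f : (ZMod 2)[X]} (hf : Irreducible f)
    (hm : f.natDegree = m) (g : ℕ → (ZMod 2)[X]) {d : ℕ} {U : Finset ℕ} (hd : d ∈ U) :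
    ∑ n ∈ Finset.range (2 ^ m), latticeSum m f (Function.update g d (natToPoly n)) U
      ≤ (m / 2 : ℝ) ^ U.card := by
  simp only [latticeSum]
  rw [Finset.sum_comm, ← sum_piFinset_size]
  refine Finset.sum_le_sum fun k hk => ?_
  rw [← Finset.mul_sum]
  refine mul_le_of_le_one_right (by positivity) ?_
  set A : ℕ → ℝ := fun n => |(1 / 2 ^ m) * ∑ l : Fin (2 ^ m), ∏ i : U, wal (k i) (fracPart m
    (toLaurent (natToPoly l * Function.update g d (natToPoly n) i) / toLaurent f))| with hA
  change ∑ n ∈ Finset.range (2 ^ m), A n ≤ 1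
  have hsplit : ∀ n, ∑ i : U, natToPoly (k i) * Function.update g d (natToPoly n) i
      = natToPoly (k ⟨d, hd⟩) * natToPoly n
        + ∑ i ∈ Finset.univ.erase (⟨d, hd⟩ : U), natToPoly (k i) * g i := by
    intro n
    rw [← Finset.add_sum_erase _ _ (Finset.mem_univ (⟨d, hd⟩ : U))]
    congr 1
    · simp
    · refine Finset.sum_congr rfl fun i hi => ?_
      have : (i : ℕ) ≠ d := fun h => (Finset.mem_erase.1 hi).1 (Subtype.ext h)
      rw [Function.update_of_ne this]
  have hkd := Finset.mem_Ico.1 (Fintype.mem_piFinset.1 hk ⟨d, hd⟩)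
  have huniq : ∀ n < 2 ^ m, ∀ l < 2 ^ m, A n ≠ 0 → A l ≠ 0 → n = l := by
    intro n hn l hl hAn hAl
    have hdvd : ∀ q, A q ≠ 0 →
        f ∣ ∑ i : U, natToPoly (k i) * Function.update g d (natToPoly q) i := fun q hq => by
      by_contra h
      exact hq (by rw [hA]; simp only; rw [mean_eq_zero hf hm hk _ h, abs_zero])
    have h1 := dvd_sub (hdvd n hAn) (hdvd l hAl)
    rw [hsplit, hsplit, add_sub_add_right_eq_sub, ← mul_sub] at h1
    have h2 := (hf.prime.dvd_or_dvd h1).resolve_left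
      (not_dvd_natToPoly hf hm (by omega) hkd.2)
    refine natToPoly_injective (sub_eq_zero.1 (Polynomial.eq_zero_of_dvd_of_degree_lt h2 ?_))
    rw [Polynomial.degree_eq_natDegree hf.ne_zero, hm]
    exact (Polynomial.degree_sub_le _ _).trans_lt
      (max_lt (degree_natToPoly_lt hn) (degree_natToPoly_lt hl))
  by_cases hex : ∃ n < 2 ^ m, A n ≠ 0
  · obtain ⟨n, hn, hAn⟩ := hex
    rw [Finset.sum_eq_single n]
    · exact abs_mean_le_one hk _
    · intro l hl hln
      by_contra hAl
      exact hln (huniq l (Finset.mem_range.1 hl) n hn hAl hAn)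
    · intro h; exact absurd (Finset.mem_range.2 hn) h
  · push Not at hex
    rw [Finset.sum_eq_zero fun n hn => hex n (Finset.mem_range.1 hn)]
    exact zero_le_one

theorem IsCBC.figureOfMerit_le {a b : ℕ → ℝ} (hab : ∀ i, a i < b i) {γ : Finset ℕ → ℝ≥0}
    {m s : ℕ} {f : (ZMod 2)[X]} {g : ℕ → (ZMod 2)[X]} (hf : Irreducible f)
    (hm : f.natDegree = m) (hg : IsCBC a b γ m s f g) {d : ℕ} (hd1 : 1 ≤ d) (hds : d ≤ s) :
    figureOfMerit a b γ m d f g ≤ 1 / 2 ^ m * ∑ U ∈ (Finset.range d).powerset with U.Nonempty,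
      (γ U : ℝ) * ∏ i ∈ U, ((m / 2 : ℝ) * (b i - a i)) := by
  have hw : ∀ U : Finset ℕ, 0 ≤ (γ U : ℝ) * ∏ i ∈ U, (b i - a i) := fun U =>
    mul_nonneg (γ U).coe_nonneg (Finset.prod_nonneg fun i _ => (sub_pos.2 (hab i)).le)
  have hprod : ∀ U : Finset ℕ, (γ U : ℝ) * ∏ i ∈ U, ((m / 2 : ℝ) * (b i - a i))
      = (γ U : ℝ) * (∏ i ∈ U, (b i - a i)) * (m / 2 : ℝ) ^ U.card := fun U => by
    rw [Finset.prod_mul_distrib, Finset.prod_const]; ring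
  induction d, hd1 using Nat.le_induction with
  | base =>
    refine le_trans (le_of_eq ?_) (mul_nonneg (by positivity) (Finset.sum_nonneg fun U _ => by
      rw [hprod]; exact mul_nonneg (hw U) (by positivity)))
    rw [figureOfMerit_eq, show (1 : ℕ) = 0 + 1 from rfl, sum_powerset_range_succ_nonempty]
    have := latticeSum_singleton_eq_zero hf hm hg.1
    simp [this, Finset.filter_singleton]
  | succ d hd1 ih =>
    have ih := ih (by omega)
    have hmin := (hg.2 d hd1 (by omega)).2
    have hstep : ∀ h : (ZMod 2)[X], figureOfMerit a b γ m (d + 1) f (Function.update g d h)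
        = figureOfMerit a b γ m d f g + ∑ V ∈ (Finset.range d).powerset,
          (γ (insert d V) : ℝ) * (∏ i ∈ insert d V, (b i - a i)) *
            latticeSum m f (Function.update g d h) (insert d V) := fun h => by
      rw [figureOfMerit_congr a b γ m f (g := g) (g' := Function.update g d h)
        fun i hi => (Function.update_of_ne hi.ne _ _).symm]
      rw [figureOfMerit_eq, figureOfMerit_eq, sum_powerset_range_succ_nonempty]
    have hsum : (2 : ℝ) ^ m * figureOfMerit a b γ m (d + 1) f g
        ≤ 2 ^ m * figureOfMerit a b γ m d f g + ∑ V ∈ (Finset.range d).powerset,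
          (γ (insert d V) : ℝ) * ∏ i ∈ insert d V, ((m / 2 : ℝ) * (b i - a i)) := by
      have h1 : ∑ n ∈ Finset.range (2 ^ m), figureOfMerit a b γ m (d + 1) f g
          ≤ ∑ n ∈ Finset.range (2 ^ m),
            figureOfMerit a b γ m (d + 1) f (Function.update g d (natToPoly n)) :=
        Finset.sum_le_sum fun n hn => hmin _ (degree_natToPoly_lt (Finset.mem_range.1 hn))
      simp only [hstep] at h1
      rw [Finset.sum_add_distrib, Finset.sum_comm] at h1
      simp only [Finset.sum_const, Finset.card_range, nsmul_eq_mul, ← Finset.mul_sum] at h1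
      push_cast at h1
      refine h1.trans (add_le_add_right (Finset.sum_le_sum fun V _ => ?_) _)
      rw [hprod]
      exact mul_le_mul_of_nonneg_left
        (sum_latticeSum_update_le hf hm g (Finset.mem_insert_self d V)) (hw _)
    rw [sum_powerset_range_succ_nonempty]
    have hpos : (0 : ℝ) < 2 ^ m := by positivity
    rw [one_div, ← div_eq_inv_mul, le_div_iff₀ hpos] at ih ⊢
    rw [mul_comm] at ih ⊢
    linarith

/-! ### The worst-case error of the constructed lattices -/

/-- The integers `2^m {h g_i / f}_m`. -/
def latticeIndex (m s : ℕ) (f : (ZMod 2)[X]) (g : ℕ → (ZMod 2)[X]) (n : Fin (2 ^ m))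
    (i : Fin s) : Fin (2 ^ m) :=
  ⟨fracIndex m (toLaurent (natToPoly n * g i) / toLaurent f), fracIndex_lt _ _⟩

theorem polyLattice_eq (m s : ℕ) (f : (ZMod 2)[X]) (g : ℕ → (ZMod 2)[X]) :
    polyLattice m s f g = fun n i => (latticeIndex m s f g n i : ℝ) / 2 ^ m := by
  ext n i
  rw [polyLattice, fracPart_eq]
  rfl

/-- The sum `∑_{∅ ≠ u ⊆ [d]} γ_u ∏_{i ∈ u} x (b_i - a_i)`. -/
def weightedSum (a b : ℕ → ℝ) (γ : Finset ℕ → ℝ≥0) (d : ℕ) (x : ℝ) : ℝ :=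
  ∑ U ∈ (Finset.range d).powerset with U.Nonempty, (γ U : ℝ) * ∏ i ∈ U, (x * (b i - a i))

theorem sum_singleton_le_sum_powerset (d : ℕ) {h : Finset ℕ → ℝ} (hh : ∀ U, 0 ≤ h U) :
    ∑ i : Fin d, h {(i : ℕ)} ≤ ∑ U ∈ (Finset.range d).powerset with U.Nonempty, h U := by
  have e := Finset.sum_map (Finset.range d)
    ⟨fun i => ({i} : Finset ℕ), Finset.singleton_injective⟩ h
  simp only [Function.Embedding.coeFn_mk] at e
  rw [Fin.sum_univ_eq_sum_range (fun i => h {i}) d, ← e]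
  refine Finset.sum_le_sum_of_subset_of_nonneg (fun U hU => ?_) fun U _ _ => hh U
  obtain ⟨i, hi, rfl⟩ := Finset.mem_map.1 hU
  simp only [Finset.mem_filter, Finset.mem_powerset]
  exact ⟨Finset.singleton_subset_iff.2 hi, Finset.singleton_nonempty i⟩

theorem IsCBC.wce_le {a b : ℕ → ℝ} (hab : ∀ i, a i < b i) {φ : ℕ → ℝ → ℝ}
    (hφ : ∀ i, IsInvertibleDensity (a i) (b i) (φ i)) {γ : Finset ℕ → ℝ≥0}
    {m s : ℕ} {f : (ZMod 2)[X]} {g : ℕ → (ZMod 2)[X]} (hf : Irreducible f)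
    (hm : f.natDegree = m) (hg : IsCBC a b γ m s f g) {d : ℕ} (hd1 : 1 ≤ d) (hds : d ≤ s) :
    wce a b φ γ (polyLattice m d f g) ≤ ENNReal.ofReal
      (1 / 2 ^ m * (weightedSum a b γ d 2 + weightedSum a b γ d (m / 2))) := by
  rw [polyLattice_eq]
  refine (WeightedQMC.wce_le hab hφ γ _).trans (ENNReal.ofReal_le_ofReal ?_)
  rw [← polyLattice_eq, mul_add]
  refine add_le_add ?_ (hg.figureOfMerit_le hab hf hm hd1 hds)
  rw [← Finset.sum_mul, mul_comm]
  refine mul_le_mul_of_nonneg_left ?_ (by positivity)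
  have hb : ∀ i, 0 < b i - a i := fun i => sub_pos.2 (hab i)
  refine le_trans (Finset.sum_le_sum fun i _ => ?_) (sum_singleton_le_sum_powerset d
    (h := fun U => (γ U : ℝ) * ∏ i ∈ U, (2 * (b i - a i))) fun U =>
    mul_nonneg (γ U).coe_nonneg (Finset.prod_nonneg fun i _ => by have := hb i; positivity))
  rw [Finset.prod_singleton, weight, Finset.map_singleton]
  refine mul_le_mul_of_nonneg_left ?_ (γ _).coe_nonneg
  have := hb i
  linarith

/-- `(m / 2)^n ≤ 2^{mδ} (n / (2 e δ ln 2))^n`. -/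
theorem half_pow_le {δ : ℝ} (hδ : 0 < δ) (m : ℕ) {n : ℕ} (hn : n ≠ 0) :
    (m / 2 : ℝ) ^ n
      ≤ 2 ^ ((m : ℝ) * δ) * ((n : ℝ) / (Real.exp 1 * δ * 2 * Real.log 2)) ^ n := by
  have hl : 0 < Real.log 2 := Real.log_pos one_lt_two
  have hn0 : (0 : ℝ) < n := by exact_mod_cast Nat.pos_of_ne_zero hn
  set y : ℝ := m * δ * Real.log 2 / n with hy
  have h1 : Real.exp 1 * y ≤ Real.exp y := by
    have h2 := Real.add_one_le_exp (y - 1)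
    rw [sub_add_cancel] at h2
    calc Real.exp 1 * y ≤ Real.exp 1 * Real.exp (y - 1) :=
          mul_le_mul_of_nonneg_left h2 (Real.exp_pos 1).le
      _ = Real.exp y := by rw [← Real.exp_add]; congr 1; ring
  have h3 : (2 : ℝ) ^ ((m : ℝ) * δ) = Real.exp y ^ n := by
    rw [← Real.exp_nat_mul, Real.rpow_def_of_pos two_pos, hy]
    congr 1
    field_simp
  rw [h3, ← mul_pow]
  refine pow_le_pow_left₀ (by positivity) ?_ n
  calc (m / 2 : ℝ) = Real.exp 1 * y * (n / (Real.exp 1 * δ * 2 * Real.log 2)) := by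
        rw [hy]; field_simp
    _ ≤ _ := mul_le_mul_of_nonneg_right h1 (by positivity)

/-- The sum in the definition of `CPoly` for a fixed dimension. -/
def cPolySum (a b : ℕ → ℝ) (γ : Finset ℕ → ℝ≥0) (δ : ℝ) (d : ℕ) : ℝ :=
  ∑ u ∈ (Finset.range d).powerset with u.Nonempty,
    (γ u : ℝ) * ∏ i ∈ u,
      (max 2 ((u.card : ℝ) / (Real.exp 1 * δ * 2 * Real.log 2)) * (b i - a i))

theorem weightedSum_two_le {a b : ℕ → ℝ} (hab : ∀ i, a i < b i) (γ : Finset ℕ → ℝ≥0) (δ : ℝ)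
    (d : ℕ) : weightedSum a b γ d 2 ≤ cPolySum a b γ δ d := by
  have hb : ∀ i, 0 ≤ b i - a i := fun i => (sub_pos.2 (hab i)).le
  refine Finset.sum_le_sum fun U _ => mul_le_mul_of_nonneg_left ?_ (γ U).coe_nonneg
  exact Finset.prod_le_prod (fun i _ => mul_nonneg zero_le_two (hb i))
    fun i _ => mul_le_mul_of_nonneg_right (le_max_left _ _) (hb i)

theorem weightedSum_half_le {a b : ℕ → ℝ} (hab : ∀ i, a i < b i) (γ : Finset ℕ → ℝ≥0) {δ : ℝ}
    (hδ : 0 < δ) (m d : ℕ) :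
    weightedSum a b γ d (m / 2) ≤ 2 ^ ((m : ℝ) * δ) * cPolySum a b γ δ d := by
  have hb : ∀ i, 0 ≤ b i - a i := fun i => (sub_pos.2 (hab i)).le
  have hl : 0 < Real.log 2 := Real.log_pos one_lt_two
  rw [cPolySum, Finset.mul_sum]
  refine Finset.sum_le_sum fun U hU => ?_
  have hU : U.card ≠ 0 := Finset.card_ne_zero.2 (Finset.mem_filter.1 hU).2
  rw [mul_left_comm]
  refine mul_le_mul_of_nonneg_left ?_ (γ U).coe_nonneg
  rw [Finset.prod_mul_distrib, Finset.prod_mul_distrib, Finset.prod_const, Finset.prod_const,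
    ← mul_assoc]
  refine mul_le_mul_of_nonneg_right ((half_pow_le hδ m hU).trans ?_)
    (Finset.prod_nonneg fun i _ => hb i)
  refine mul_le_mul_of_nonneg_left ?_ (by positivity)
  exact pow_le_pow_left₀ (by positivity) (le_max_right _ _) _

theorem two_rpow_split (m : ℕ) (δ : ℝ) :
    (2 : ℝ) ^ ((m : ℝ) * (1 - δ)) * 2 ^ ((m : ℝ) * δ) = 2 ^ m := by
  rw [← Real.rpow_add two_pos, ← Real.rpow_natCast]
  congr 1
  ring

theorem wce_le_cPoly {a b : ℕ → ℝ} (hab : ∀ i, a i < b i) {φ : ℕ → ℝ → ℝ}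
    (hφ : ∀ i, IsInvertibleDensity (a i) (b i) (φ i)) {γ : Finset ℕ → ℝ≥0} {δ : ℝ} (hδ : 0 < δ)
    {m s : ℕ} {f : (ZMod 2)[X]} {g : ℕ → (ZMod 2)[X]} (hf : Irreducible f)
    (hm : f.natDegree = m) (hg : IsCBC a b γ m s f g) {d : ℕ} (hd1 : 1 ≤ d) (hds : d ≤ s) :
    wce a b φ γ (polyLattice m d f g)
      ≤ 2 * CPoly a b γ δ / (2 : ℝ≥0∞) ^ ((m : ℝ) * (1 - δ)) := by
  have hb : ∀ i, 0 ≤ b i - a i := fun i => (sub_pos.2 (hab i)).le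
  have hS : 0 ≤ cPolySum a b γ δ d := Finset.sum_nonneg fun U _ =>
    mul_nonneg (γ U).coe_nonneg (Finset.prod_nonneg fun i _ =>
      mul_nonneg (zero_le_two.trans (le_max_left _ _)) (hb i))
  have hC : ENNReal.ofReal (cPolySum a b γ δ d) ≤ CPoly a b γ δ :=
    le_iSup (fun s => ENNReal.ofReal (cPolySum a b γ δ s)) d
  have hpow : (0 : ℝ) < 2 ^ ((m : ℝ) * (1 - δ)) := by positivity
  have hone : (1 : ℝ) ≤ 2 ^ ((m : ℝ) * δ) := Real.one_le_rpow one_le_two (by positivity)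
  calc wce a b φ γ (polyLattice m d f g)
      ≤ ENNReal.ofReal (2 * cPolySum a b γ δ d / 2 ^ ((m : ℝ) * (1 - δ))) := by
        refine (hg.wce_le hab hφ hf hm hd1 hds).trans (ENNReal.ofReal_le_ofReal ?_)
        rw [← two_rpow_split m δ]
        have h1 := weightedSum_two_le hab γ δ d
        have h2 := weightedSum_half_le hab γ hδ m d
        have h3 : weightedSum a b γ d 2 + weightedSum a b γ d (m / 2)
            ≤ 2 ^ ((m : ℝ) * δ) * (2 * cPolySum a b γ δ d) := by nlinarith
        refine (mul_le_mul_of_nonneg_left h3 (by positivity)).trans (le_of_eq ?_)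
        field_simp
    _ = 2 * ENNReal.ofReal (cPolySum a b γ δ d) / (2 : ℝ≥0∞) ^ ((m : ℝ) * (1 - δ)) := by
        rw [ENNReal.ofReal_div_of_pos hpow, ENNReal.ofReal_mul zero_le_two,
          ← ENNReal.ofReal_rpow_of_pos two_pos, ENNReal.ofReal_ofNat]
    _ ≤ _ := by gcongr

/-! ### Summable weight ratios -/

theorem STerm_nonneg {a b : ℕ → ℝ} (hab : ∀ i, a i < b i) (γ : Finset ℕ → ℝ≥0) (i : ℕ) :
    0 ≤ STerm a b γ i :=
  mul_nonneg (sub_pos.2 (hab i)).le (NNReal.coe_nonneg _)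

theorem weight_insert_le {a b : ℕ → ℝ} (hab : ∀ i, a i < b i) {γ : Finset ℕ → ℝ≥0}
    (hγ : ∀ u, 0 < γ u) {i : ℕ} {V : Finset ℕ} (hV : V ⊆ Finset.range i) :
    (γ (insert i V) : ℝ) * (b i - a i)
      ≤ ((if V = ∅ then 1 else γ V : ℝ≥0) : ℝ) * STerm a b γ i := by
  have hpos : 0 < (if V = ∅ then 1 else γ V : ℝ≥0) := by
    split_ifs
    · exact one_pos
    · exact hγ V
  have h1 : weightRatio γ i V ≤ (Finset.range i).powerset.sup (weightRatio γ i) :=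
    Finset.le_sup (Finset.mem_powerset.2 hV)
  rw [weightRatio, div_le_iff₀ hpos] at h1
  have h2 := NNReal.coe_le_coe.2 h1
  rw [NNReal.coe_mul] at h2
  rw [STerm]
  calc _ ≤ _ := mul_le_mul_of_nonneg_right h2 (sub_pos.2 (hab i)).le
    _ = _ := by ring

theorem weightedSum_le_prod {a b : ℕ → ℝ} (hab : ∀ i, a i < b i) {γ : Finset ℕ → ℝ≥0}
    (hγ : ∀ u, 0 < γ u) {x : ℝ} (hx : 0 ≤ x) (d : ℕ) :
    weightedSum a b γ d x ≤ ∏ i ∈ Finset.range d, (1 + x * STerm a b γ i) := by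
  have hb : ∀ i, 0 ≤ b i - a i := fun i => (sub_pos.2 (hab i)).le
  set h : Finset ℕ → ℝ := fun U =>
    ((if U = ∅ then 1 else γ U : ℝ≥0) : ℝ) * ∏ i ∈ U, (x * (b i - a i)) with hh
  have h0 : ∀ U, 0 ≤ h U := fun U => mul_nonneg (NNReal.coe_nonneg _)
    (Finset.prod_nonneg fun i _ => mul_nonneg hx (hb i))
  calc weightedSum a b γ d x
      = ∑ U ∈ (Finset.range d).powerset with U.Nonempty, h U := by
        refine Finset.sum_congr rfl fun U hU => ?_
        rw [hh]
        simp only [if_neg (Finset.nonempty_iff_ne_empty.1 (Finset.mem_filter.1 hU).2)]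
    _ ≤ ∑ U ∈ (Finset.range d).powerset, h U :=
        Finset.sum_le_sum_of_subset_of_nonneg (Finset.filter_subset _ _) fun U _ _ => h0 U
    _ ≤ _ := by
        induction d with
        | zero => simp [hh]
        | succ d ih =>
          rw [Finset.prod_range_succ, Finset.range_add_one,
            Finset.sum_powerset_insert (by simp), mul_add, mul_one]
          have hS := STerm_nonneg hab γ d
          refine add_le_add ih (le_trans ?_
            (mul_le_mul_of_nonneg_right ih (mul_nonneg hx hS)))
          rw [Finset.sum_mul]
          refine Finset.sum_le_sum fun V hV => ?_
          have hV := Finset.mem_powerset.1 hV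
          have hd : d ∉ V := fun h => by simpa using hV h
          simp only [hh]
          rw [if_neg (Finset.insert_ne_empty d V), Finset.prod_insert hd]
          have h1 := weight_insert_le hab hγ hV
          have h2 : 0 ≤ x * ∏ i ∈ V, (x * (b i - a i)) :=
            mul_nonneg hx (Finset.prod_nonneg fun i _ => mul_nonneg hx (hb i))
          calc _ = (γ (insert d V) : ℝ) * (b d - a d) * (x * ∏ i ∈ V, (x * (b i - a i))) := by ring
            _ ≤ _ := mul_le_mul_of_nonneg_right h1 h2
            _ = _ := by ring

theorem weightedSum_add_le {a b : ℕ → ℝ} (hab : ∀ i, a i < b i) (γ : Finset ℕ → ℝ≥0) (d : ℕ)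
    {x y : ℝ} (hx : 0 ≤ x) (hy : 0 ≤ y) :
    weightedSum a b γ d x + weightedSum a b γ d y ≤ weightedSum a b γ d (x + y) := by
  rw [weightedSum, weightedSum, ← Finset.sum_add_distrib]
  refine Finset.sum_le_sum fun U hU => ?_
  rw [← mul_add]
  refine mul_le_mul_of_nonneg_left ?_ (γ U).coe_nonneg
  simp only [Finset.prod_mul_distrib, Finset.prod_const]
  rw [← add_mul]
  exact mul_le_mul_of_nonneg_right
    (pow_add_pow_le hx hy (Finset.card_ne_zero.2 (Finset.mem_filter.1 hU).2))
    (Finset.prod_nonneg fun i _ => (sub_pos.2 (hab i)).le)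

theorem weightedSum_mono {a b : ℕ → ℝ} (hab : ∀ i, a i < b i) (γ : Finset ℕ → ℝ≥0) (d : ℕ)
    {x y : ℝ} (hx : 0 ≤ x) (hxy : x ≤ y) :
    weightedSum a b γ d x ≤ weightedSum a b γ d y := by
  have hb : ∀ i, 0 ≤ b i - a i := fun i => (sub_pos.2 (hab i)).le
  exact Finset.sum_le_sum fun U _ => mul_le_mul_of_nonneg_left
    (Finset.prod_le_prod (fun i _ => mul_nonneg hx (hb i))
      fun i _ => mul_le_mul_of_nonneg_right hxy (hb i)) (γ U).coe_nonneg

theorem prod_one_add_mul_le {S : ℕ → ℝ} (hS : ∀ i, 0 ≤ S i) (hs : Summable S) {x A T : ℝ}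
    (hx : 0 ≤ x) (hA : 1 ≤ A) {β : ℕ} (hT : ∑' i, S (i + β) ≤ T) (d : ℕ) :
    ∏ i ∈ Finset.range d, (1 + x * S i)
      ≤ A ^ β * Real.exp (x * ((∑' i, S i) / A + T)) := by
  have hA0 : 0 < A := one_pos.trans_le hA
  have h1 : ∀ i, 1 ≤ 1 + x * S i := fun i => le_add_of_nonneg_right (mul_nonneg hx (hS i))
  have h0 : ∀ i, 0 ≤ 1 + x * S i := fun i => zero_le_one.trans (h1 i)
  have hfirst : ∏ i ∈ Finset.range β, (1 + x * S i)
      ≤ A ^ β * Real.exp (x * ((∑' i, S i) / A)) := by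
    calc ∏ i ∈ Finset.range β, (1 + x * S i)
        ≤ ∏ i ∈ Finset.range β, (A * Real.exp (x * (S i / A))) := by
          refine Finset.prod_le_prod (fun i _ => h0 i) fun i _ => ?_
          have := Real.add_one_le_exp (x * (S i / A))
          calc 1 + x * S i ≤ A * (x * (S i / A) + 1) := by
                have e : A * (x * (S i / A) + 1) = x * S i + A := by field_simp
                rw [e]; linarith
            _ ≤ _ := mul_le_mul_of_nonneg_left this hA0.le
      _ = A ^ β * Real.exp (x * ((∑ i ∈ Finset.range β, S i) / A)) := by
          rw [Finset.prod_mul_distrib, Finset.prod_const, Finset.card_range, ← Real.exp_sum,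
            ← Finset.mul_sum, Finset.sum_div]
      _ ≤ _ := by
          have := hs.sum_le_tsum (Finset.range β) fun i _ => hS i
          gcongr
  have hsecond : ∏ i ∈ Finset.range d, (1 + x * S (β + i)) ≤ Real.exp (x * T) := by
    calc ∏ i ∈ Finset.range d, (1 + x * S (β + i))
        ≤ ∏ i ∈ Finset.range d, Real.exp (x * S (β + i)) :=
          Finset.prod_le_prod (fun i _ => h0 _) fun i _ => by
            rw [add_comm]; exact Real.add_one_le_exp _
      _ = Real.exp (x * ∑ i ∈ Finset.range d, S (i + β)) := by
          rw [← Real.exp_sum, ← Finset.mul_sum]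
          simp only [add_comm β]
      _ ≤ _ := by
          have := ((summable_nat_add_iff β).2 hs).sum_le_tsum (Finset.range d)
            fun i _ => hS (i + β)
          have := this.trans hT
          gcongr
  calc ∏ i ∈ Finset.range d, (1 + x * S i)
      ≤ ∏ i ∈ Finset.range (β + d), (1 + x * S i) :=
        Finset.prod_le_prod_of_subset_of_one_le (Finset.range_mono (Nat.le_add_left d β))
          (fun i _ => h0 i) fun i _ _ => h1 i
    _ = (∏ i ∈ Finset.range β, (1 + x * S i)) * ∏ i ∈ Finset.range d, (1 + x * S (β + i)) :=
        Finset.prod_range_add _ _ _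
    _ ≤ _ := mul_le_mul hfirst hsecond (Finset.prod_nonneg fun i _ => h0 _) (by positivity)
    _ = _ := by rw [mul_assoc, ← Real.exp_add, ← mul_add]

theorem wce_le_of_summable {a b : ℕ → ℝ} (hab : ∀ i, a i < b i) {φ : ℕ → ℝ → ℝ}
    (hφ : ∀ i, IsInvertibleDensity (a i) (b i) (φ i)) {γ : Finset ℕ → ℝ≥0} (hγ : ∀ u, 0 < γ u)
    (hs : Summable (STerm a b γ)) {δ : ℝ} (hδ : 0 < δ)
    (hδS : δ < 5 * (∑' i, STerm a b γ i) / Real.log 2) {β : ℕ}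
    (hβ : ∑' i, STerm a b γ (i + β) < δ * Real.log 2 / 5)
    {m s : ℕ} {f : (ZMod 2)[X]} {g : ℕ → (ZMod 2)[X]} (hf : Irreducible f)
    (hm : f.natDegree = m) (hg : IsCBC a b γ m s f g) {d : ℕ} (hd1 : 1 ≤ d) (hds : d ≤ s) :
    wce a b φ γ (polyLattice m d f g) ≤
      ENNReal.ofReal ((5 * (∑' i, STerm a b γ i) / (δ * Real.log 2)) ^ β /
        (2 : ℝ) ^ ((m : ℝ) * (1 - δ))) := by
  have hl : 0 < Real.log 2 := Real.log_pos one_lt_two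
  set S := ∑' i, STerm a b γ i with hS
  have hSpos : 0 < S := by
    have := hδ.trans hδS
    by_contra hle
    exact absurd this (not_lt.2 (div_nonpos_of_nonpos_of_nonneg (by linarith) hl.le))
  have hA : 1 ≤ 5 * S / (δ * Real.log 2) := by
    rw [lt_div_iff₀ hl] at hδS
    rw [one_le_div (by positivity)]
    exact hδS.le
  have hm1 : (1 : ℝ) ≤ m := by exact_mod_cast hm ▸ hf.natDegree_pos
  refine (hg.wce_le hab hφ hf hm hd1 hds).trans (ENNReal.ofReal_le_ofReal ?_)
  have h1 : weightedSum a b γ d 2 + weightedSum a b γ d (m / 2)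
      ≤ weightedSum a b γ d (5 * m / 2) :=
    (weightedSum_add_le hab γ d zero_le_two (by positivity)).trans
      (weightedSum_mono hab γ d (by positivity) (by linarith))
  have h2 := prod_one_add_mul_le (STerm_nonneg hab γ) hs (x := 5 * m / 2) (by positivity) hA
    hβ.le d
  have h3 : Real.exp (5 * m / 2 * (S / (5 * S / (δ * Real.log 2)) + δ * Real.log 2 / 5))
      = 2 ^ ((m : ℝ) * δ) := by
    rw [Real.rpow_def_of_pos two_pos]
    congr 1
    field_simp
    ring
  rw [← hS, h3] at h2
  have h4 := (h1.trans (weightedSum_le_prod hab hγ (by positivity) d)).trans h2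
  refine (mul_le_mul_of_nonneg_left h4 (by positivity)).trans (le_of_eq ?_)
  rw [← two_rpow_split m δ]
  field_simp

/-! ### Tractability -/

theorem exists_irreducible_natDegree {m : ℕ} (hm : m ≠ 0) :
    ∃ f : (ZMod 2)[X], Irreducible f ∧ f.natDegree = m := by
  have : Fact (Nat.Prime 2) := ⟨Nat.prime_two⟩
  obtain ⟨α, hα⟩ := Field.exists_primitive_element (ZMod 2) (GaloisField 2 m)
  refine ⟨minpoly (ZMod 2) α, minpoly.irreducible (Algebra.IsIntegral.isIntegral α), ?_⟩
  rw [(Field.primitive_element_iff_minpoly_natDegree_eq (ZMod 2) α).1 hα, GaloisField.finrank 2 hm]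

theorem exists_isCBC (a b : ℕ → ℝ) (γ : Finset ℕ → ℝ≥0) (m : ℕ) (f : (ZMod 2)[X]) (s : ℕ) :
    ∃ g, IsCBC a b γ m s f g := by
  induction s with
  | zero => exact ⟨fun _ => 1, rfl, fun d h1 h2 => absurd h2 (by omega)⟩
  | succ s ih =>
    obtain ⟨g, hg0, hg⟩ := ih
    rcases Nat.eq_zero_or_pos s with rfl | hs
    · exact ⟨g, hg0, fun d h1 h2 => absurd h2 (by omega)⟩
    obtain ⟨n, hn, hmin⟩ := Finset.exists_min_image (Finset.range (2 ^ m))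
      (fun n => figureOfMerit a b γ m (s + 1) f (Function.update g s (natToPoly n)))
      ⟨0, Finset.mem_range.2 (by positivity)⟩
    refine ⟨Function.update g s (natToPoly n), ?_, fun d hd1 hds => ?_⟩
    · rw [Function.update_of_ne (by omega), hg0]
    rcases Nat.lt_succ_iff_lt_or_eq.1 hds with hlt | rfl
    · rw [Function.update_of_ne hlt.ne]
      refine ⟨(hg d hd1 hlt).1, fun h hh => ?_⟩
      rw [figureOfMerit_congr a b γ m f (g := Function.update g s (natToPoly n)) (g' := g)
          fun i hi => Function.update_of_ne (by omega) _ _,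
        figureOfMerit_congr a b γ m f
          (g := Function.update (Function.update g s (natToPoly n)) d h)
          (g' := Function.update g d h) fun i hi => by
            rw [Function.update_comm hlt.ne', Function.update_of_ne (by omega)]]
      exact (hg d hd1 hlt).2 h hh
    · rw [Function.update_self]
      refine ⟨degree_natToPoly_lt (Finset.mem_range.1 hn), fun h hh => ?_⟩
      obtain ⟨l, hl, rfl⟩ := exists_natToPoly_eq hh
      rw [Function.update_idem]
      exact hmin l (Finset.mem_range.2 hl)

theorem fracIndex_div_injective {m : ℕ} {f : (ZMod 2)[X]} (hf : f ≠ 0) (hm : f.natDegree = m)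
    {n l : ℕ} (hn : n < 2 ^ m) (hl : l < 2 ^ m)
    (h : fracIndex m (toLaurent (natToPoly n) / toLaurent f)
      = fracIndex m (toLaurent (natToPoly l) / toLaurent f)) : n = l := by
  by_contra hne
  set P := natToPoly n - natToPoly l with hP
  have hP0 : P ≠ 0 := sub_ne_zero.2 fun e => hne (natToPoly_injective e)
  have hdeg : P.natDegree < m := by
    rw [Polynomial.natDegree_lt_iff_degree_lt hP0]
    exact (Polynomial.degree_sub_le _ _).trans_lt
      (max_lt (degree_natToPoly_lt hn) (degree_natToPoly_lt hl))
  have hc : ∀ i < m, (toLaurent P / toLaurent f).coeff ((i : ℤ) + 1) = 0 := by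
    intro i hi
    have h1 := testBit_fracIndex hi (toLaurent (natToPoly n) / toLaurent f)
    rw [h, testBit_fracIndex hi] at h1
    rw [hP, map_sub, sub_div, HahnSeries.coeff_sub, sub_eq_zero]
    have key : ∀ y z : ZMod 2, decide (z = 1) = decide (y = 1) → y = z := by decide
    exact key _ _ h1
  refine coeff_div_order_ne_zero hP0 hf ?_
  have := hc (m - 1 - P.natDegree) (by omega)
  rwa [show ((m - 1 - P.natDegree : ℕ) : ℤ) + 1 = (f.natDegree : ℤ) - P.natDegree by omega] at this

theorem polyLattice_mem_Ico (m s : ℕ) (f : (ZMod 2)[X]) (g : ℕ → (ZMod 2)[X]) (n : Fin (2 ^ m))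
    (i : Fin s) : polyLattice m s f g n i ∈ Set.Ico (0 : ℝ) 1 := by
  rw [polyLattice_eq]
  refine ⟨by positivity, (div_lt_one (by positivity)).2 ?_⟩
  exact_mod_cast (latticeIndex m s f g n i).2

theorem polyLattice_injective {m s : ℕ} {f : (ZMod 2)[X]} {g : ℕ → (ZMod 2)[X]} (hf : f ≠ 0)
    (hm : f.natDegree = m) (hs : 1 ≤ s) (hg : g 0 = 1) :
    Function.Injective (polyLattice m s f g) := by
  intro n l h
  have h0 := congrFun h ⟨0, hs⟩
  simp only [polyLattice, hg, mul_one] at h0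
  rw [fracPart_eq, fracPart_eq, div_left_inj' (by positivity)] at h0
  exact Fin.ext (fracIndex_div_injective hf hm n.2 l.2 (by exact_mod_cast h0))

theorem exists_two_pow_mem_Icc {X : ℝ} (hX : 1 ≤ X) :
    ∃ m : ℕ, m ≠ 0 ∧ X ≤ 2 ^ m ∧ (2 : ℝ) ^ m ≤ 2 * X := by
  obtain ⟨n, h1, h2⟩ := exists_nat_pow_near hX one_lt_two
  exact ⟨n + 1, Nat.succ_ne_zero n, h2.le, by rw [pow_succ']; linarith⟩

/-- Error bounds `K / 2^{mr}` for all CBC-constructed polynomial lattices yield strong polynomial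
tractability. -/
theorem sptBound_of_wce_le {a b : ℕ → ℝ} {φ : ℕ → ℝ → ℝ} {γ : Finset ℕ → ℝ≥0} {K r : ℝ}
    (hr : 0 < r)
    (h : ∀ (m s : ℕ) (f : (ZMod 2)[X]) (g : ℕ → (ZMod 2)[X]), Irreducible f → f.natDegree = m →
      IsCBC a b γ m s f g → 1 ≤ s →
      wce a b φ γ (polyLattice m s f g) ≤ ENNReal.ofReal (K / 2 ^ ((m : ℝ) * r))) :
    SPTBound a b φ γ (1 / r) := by
  set K' := max K 1 with hK'
  have hK1 : 1 ≤ K' := le_max_right _ _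
  have hK0 : 0 < K' := one_pos.trans_le hK1
  refine ⟨2 * K' ^ (1 / r), by positivity, fun s hs ε hε hε1 => ?_⟩
  have hX : 1 ≤ (K' / ε) ^ (1 / r) :=
    Real.one_le_rpow ((one_le_div hε).2 (hε1.trans hK1)) (by positivity)
  obtain ⟨m, hm0, hm1, hm2⟩ := exists_two_pow_mem_Icc hX
  obtain ⟨f, hf, hfm⟩ := exists_irreducible_natDegree hm0
  obtain ⟨g, hg⟩ := exists_isCBC a b γ m f s
  have hle : K / 2 ^ ((m : ℝ) * r) ≤ ε := by
    rw [div_le_iff₀ (by positivity)]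
    have h1 : K' / ε ≤ 2 ^ ((m : ℝ) * r) := by
      have := Real.rpow_le_rpow (by positivity) hm1 hr.le
      rwa [← Real.rpow_mul (by positivity), one_div_mul_cancel hr.ne', Real.rpow_one,
        ← Real.rpow_natCast, ← Real.rpow_mul zero_le_two] at this
    rw [div_le_iff₀ hε] at h1
    linarith [le_max_left K 1]
  have hwce := (h m s f g hf hfm hg hs).trans (ENNReal.ofReal_le_ofReal hle)
  calc infoComplexity a b φ γ ε s ≤ ((2 ^ m : ℕ) : ℝ≥0∞) :=
        iInf₂_le (2 ^ m) ⟨Nat.one_le_two_pow, polyLattice m s f g,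
          polyLattice_injective hf.ne_zero hfm hs hg.1, polyLattice_mem_Ico m s f g, hwce⟩
    _ = ENNReal.ofReal (2 ^ m) := by
        rw [ENNReal.ofReal_pow zero_le_two, ENNReal.ofReal_ofNat]; push_cast; rfl
    _ ≤ _ := by
        refine ENNReal.ofReal_le_ofReal (hm2.trans (le_of_eq ?_))
        rw [Real.div_rpow hK0.le hε.le, Real.rpow_neg hε.le]
        ring

theorem tractable_of_sptBound {a b : ℕ → ℝ} {φ : ℕ → ℝ → ℝ} {γ : Finset ℕ → ℝ≥0} {τ : ℝ}
    (hτ : 0 < τ) (h : SPTBound a b φ γ τ) :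
    StronglyPolynomiallyTractable a b φ γ ∧ sptExponent a b φ γ ≤ τ :=
  ⟨⟨τ, hτ, h⟩, csInf_le ⟨0, fun _ hx => hx.1.le⟩ ⟨hτ, h⟩⟩

theorem exists_tsum_nat_add_lt {S : ℕ → ℝ} {c : ℝ} (hc : 0 < c) :
    ∃ β : ℕ, ∑' i, S (i + β) < c :=
  ((tendsto_sum_nat_add S).eventually_lt_const hc).exists

end WeightedQMC

end
open WeightedQMC in
theorem mainTheorem10 (a b : ℕ → ℝ) (hab : ∀ i, a i < b i)
    (φ : ℕ → ℝ → ℝ) (hφ : ∀ i, IsInvertibleDensity (a i) (b i) (φ i))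
    (γ : Finset ℕ → ℝ≥0) :
    (∀ δ : ℝ, 0 < δ → δ < 1 → CPoly a b γ δ < ⊤ →
      (∀ (m s : ℕ) (f : (ZMod 2)[X]) (g : ℕ → (ZMod 2)[X]),
        Irreducible f → f.natDegree = m → IsCBC a b γ m s f g →
        ∀ d, 1 ≤ d → d ≤ s →
          wce a b φ γ (polyLattice m d f g) ≤
            2 * CPoly a b γ δ / (2 : ℝ≥0∞) ^ ((m : ℝ) * (1 - δ))) ∧
      StronglyPolynomiallyTractable a b φ γ ∧ sptExponent a b φ γ ≤ 1 / (1 - δ)) ∧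
    ((∀ u, 0 < γ u) → Summable (STerm a b γ) →
      ∀ δ : ℝ, 0 < δ → δ < min 1 (5 * (∑' i, STerm a b γ i) / Real.log 2) →
      (∀ β : ℕ, ∑' i, STerm a b γ (i + β) < δ * Real.log 2 / 5 →
        ∀ (m s : ℕ) (f : (ZMod 2)[X]) (g : ℕ → (ZMod 2)[X]),
          Irreducible f → f.natDegree = m → IsCBC a b γ m s f g →
          ∀ d, 1 ≤ d → d ≤ s →
            wce a b φ γ (polyLattice m d f g) ≤
              ENNReal.ofReal ((5 * (∑' i, STerm a b γ i) / (δ * Real.log 2)) ^ β /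
                (2 : ℝ) ^ ((m : ℝ) * (1 - δ)))) ∧
      StronglyPolynomiallyTractable a b φ γ ∧ sptExponent a b φ γ ≤ 1 / (1 - δ)) := by
  refine ⟨fun δ hδ hδ1 hC => ⟨fun m s f g hf hm hg d hd1 hds =>
    wce_le_cPoly hab hφ hδ hf hm hg hd1 hds, ?_⟩, fun hγ hs δ hδ hδ1 => ?_⟩
  · refine tractable_of_sptBound (one_div_pos.2 (sub_pos.2 hδ1))
      (sptBound_of_wce_le (K := 2 * (CPoly a b γ δ).toReal) (sub_pos.2 hδ1)
        fun m s f g hf hm hg hs => ?_)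
    refine (wce_le_cPoly hab hφ hδ hf hm hg hs le_rfl).trans (le_of_eq ?_)
    rw [ENNReal.ofReal_div_of_pos (by positivity), ENNReal.ofReal_mul zero_le_two,
      ENNReal.ofReal_toReal hC.ne, ← ENNReal.ofReal_rpow_of_pos two_pos, ENNReal.ofReal_ofNat]
  · obtain ⟨hδ2, hδ3⟩ := lt_min_iff.1 hδ1
    have hmain := fun (β : ℕ) (hβ : ∑' i, STerm a b γ (i + β) < δ * Real.log 2 / 5)
        (m s : ℕ) (f : (ZMod 2)[X]) (g : ℕ → (ZMod 2)[X]) (hf : Irreducible f)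
        (hm : f.natDegree = m) (hg : IsCBC a b γ m s f g) (d : ℕ) (hd1 : 1 ≤ d) (hds : d ≤ s) =>
      wce_le_of_summable hab hφ hγ hs hδ hδ3 hβ hf hm hg hd1 hds
    obtain ⟨β, hβ⟩ := exists_tsum_nat_add_lt (S := STerm a b γ)
      (c := δ * Real.log 2 / 5) (by have := Real.log_pos one_lt_two; positivity)
    exact ⟨hmain, tractable_of_sptBound (one_div_pos.2 (sub_pos.2 hδ2))
      (sptBound_of_wce_le (sub_pos.2 hδ2) fun m s f g hf hm hg hs =>
        hmain β hβ m s f g hf hm hg s hs le_rfl)⟩
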